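/- Let $H$ be a separable complex Hilbert space, let $A:D(A)\subset H\to H$ be a strictly positive selfadjoint operator (that is, $\langle Au,u\rangle\ge c\|u\|^2$ on $D(A)$ for some $c>0$), so that $\sigma(A)\subset(0,\infty)$, and let $f:\sigma(A)\to[0,\infty)$ be continuous. Let $f(A)=\int_{\sigma(A)}f\,dE_A$ and $A^{1/2}=\int_{\sigma(A)}\sqrt{s}\,dE_A(s)$ be defined by the functional calculus, $E_A$ being the spectral measure of $A$. Let $H^1=D(A^{1/2})$ with norm $\|u\|_1=\|A^{1/2}u\|$, let $\mathcal H=H^1\times H$ with norm $(\|u\|_1^2+\|v\|^2)^{1/2}$, and let $\mathbb A$ be the operator on $\mathcal H$ given by $$\mathbb A(u,v)=(v,\,-Au-f(A)v),\qquad D(\mathbb A)=\{(u,v)\in\mathcal H:\ v\in H^1,\ Au+f(A)v\in H\},$$ where $Au+f(A)v=h\in H$ means that $\langle Aw,u\rangle+\langle f(A)w,v\rangle=\langle w,h\rangle$ for all $w\in D(A)\cap D(f(A))$. For $s\in\sigma(A)$ let $$\xi_s^\pm=\begin{cases}-\frac{f(s)}2\pm\frac{\sqrt{f(s)^2-4s}}2&\text{if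 } f(s)\ge 2\sqrt s,\\[1mm] -\frac{f(s)}2\pm i\,\frac{\sqrt{4s-f(s)^2}}2&\text{if } f(s)<2\sqrt s,\end{cases}$$ be the two roots of $\xi^2+f(s)\xi+s=0$, and let $$\Lambda=\Big\{\ell>0:\ \exists\, s_n\in\sigma(A)\text{ with } s_n\to\infty\text{ and }\lim_{n\to\infty}\frac{f(s_n)}{s_n}=\ell\Big\}$$ (possibly empty). Then $$\sigma(\mathbb A)\setminus\{0\}=\bigcup_{s\in\sigma(A)}\{\xi_s^+,\xi_s^-\}\ \cup\ \bigcup_{\ell\in\Lambda}\Big\{-\frac1\ell\Big\}.$$ -/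

import Mathlib

open Filter Topology MeasureTheory

noncomputable section

namespace DampedEvolution

/-! ### Spectrum of an unbounded operator -/

section Spectrum

variable {E : Type*} [SeminormedAddCommGroup E] [NormedSpace ℂ E]

/-- The resolvent set of an unbounded operator `T` on `E`: those `ξ` for which `ξ - T`, as a map from
the domain of `T` to `E`, is bijective with bounded (everywhere defined) inverse `R`. -/
def resolventSet (T : E →ₗ.[ℂ] E) : Set ℂ :=
  {ξ | ∃ R : E →L[ℂ] E,
      (∀ y : E, ∃ h : R y ∈ T.domain, ξ • R y - T ⟨R y, h⟩ = y) ∧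
      (∀ x : T.domain, R (ξ • (x : E) - T x) = x)}

/-- The spectrum of an unbounded operator. -/
def spectrum (T : E →ₗ.[ℂ] E) : Set ℂ := (resolventSet T)ᶜ

/-- The real points of the spectrum. For a selfadjoint operator this is the whole spectrum, seen as a
subset of `ℝ`. -/
def realSpectrum (T : E →ₗ.[ℂ] E) : Set ℝ := {s | (s : ℂ) ∈ spectrum T}

end Spectrum

variable {H : Type*} [NormedAddCommGroup H] [InnerProductSpace ℂ H] [CompleteSpace H]

/-! ### Spectral measures and functional calculus -/

/-- A spectral measure on a measurable space `Ω`, with values in the selfadjoint projections of `H`.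
The values of `proj` on non-measurable sets are irrelevant. (Mathlib's `inner ℂ v u` is linear in the
second variable `u`.) -/
structure SpectralMeasure (Ω : Type*) [MeasurableSpace Ω] (H : Type*) [NormedAddCommGroup H]
    [InnerProductSpace ℂ H] [CompleteSpace H] where
  /-- The projection attached to a measurable set. -/
  proj : Set Ω → H →L[ℂ] H
  isStarProjection : ∀ ω, MeasurableSet ω → IsStarProjection (proj ω)
  proj_empty : proj ∅ = 0
  proj_univ : proj Set.univ = 1
  proj_inter : ∀ ω₁ ω₂, MeasurableSet ω₁ → MeasurableSet ω₂ → proj (ω₁ ∩ ω₂) = proj ω₁ * proj ω₂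
  proj_union : ∀ ω₁ ω₂, MeasurableSet ω₁ → MeasurableSet ω₂ → ω₁ ∩ ω₂ = ∅ →
    proj (ω₁ ∪ ω₂) = proj ω₁ + proj ω₂
  exists_complexMeasure : ∀ u v : H, ∃ μ : ComplexMeasure Ω,
    ∀ ω, MeasurableSet ω → μ ω = inner ℂ v (proj ω u)

namespace SpectralMeasure

variable {Ω : Type*} [MeasurableSpace Ω]

/-- The complex measure `μ_{u,v}(ω) = ⟨E(ω)u, v⟩`. -/
def measure (E : SpectralMeasure Ω H) (u v : H) : ComplexMeasure Ω :=
  (E.exists_complexMeasure u v).choose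

/-- `T = ∫ φ dE`: the domain of `T` is `{u | ∫ |φ|² dμ_{u,u} < ∞}`, and `⟨T u, v⟩ = ∫ φ dμ_{u,v}` for
all `u` in this domain and all `v` in `H`. -/
def IsIntegral (E : SpectralMeasure Ω H) (φ : Ω → ℂ) (T : H →ₗ.[ℂ] H) : Prop :=
  (∀ u : H, u ∈ T.domain ↔ (E.measure u u).Integrable (fun s => ‖φ s‖ ^ 2)) ∧
  ∀ (u : T.domain) (v : H),
    inner ℂ v (T u) = (E.measure u v).integral φ (ContinuousLinearMap.mul ℝ ℂ)

/-- The operator `∫ φ dE`, characterized by `IsIntegral`. For continuous `φ` it exists and is unique. -/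
def integral (E : SpectralMeasure Ω H) (φ : Ω → ℂ) : H →ₗ.[ℂ] H :=
  Classical.epsilon fun T => E.IsIntegral φ T

end SpectralMeasure

/-- `E` is the spectral measure of `A`: it lives on `σ(A)` and `A = ∫ s dE(s)`. -/
def IsSpectralMeasureOf (A : H →ₗ.[ℂ] H) (E : SpectralMeasure (realSpectrum A) H) : Prop :=
  E.IsIntegral (fun s => ((s : ℝ) : ℂ)) A

open Classical in
/-- The operator `φ(A) = ∫ φ dE_A`, where `E_A` is the spectral measure of `A`. For selfadjoint `A` the
spectral measure exists and is unique; if `A` has none, the value is irrelevant. -/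
def functionalCalculus (A : H →ₗ.[ℂ] H) (φ : realSpectrum A → ℂ) : H →ₗ.[ℂ] H :=
  if h : ∃ E : SpectralMeasure (realSpectrum A) H, IsSpectralMeasureOf A E then
    h.choose.integral φ
  else ⊥

/-- `f(A)` for a real function `f` on the spectrum. -/
def realCalculus (A : H →ₗ.[ℂ] H) (f : realSpectrum A → ℝ) : H →ₗ.[ℂ] H :=
  functionalCalculus A fun s => (f s : ℂ)

/-- The square root `A^{1/2}`. -/
def sqrtOp (A : H →ₗ.[ℂ] H) : H →ₗ.[ℂ] H :=
  realCalculus A fun s => Real.sqrt s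

/-- `A` is strictly positive. -/
def IsStrictlyPositive (A : H →ₗ.[ℂ] H) : Prop :=
  ∃ c : ℝ, 0 < c ∧ ∀ u : A.domain, c * ‖(u : H)‖ ^ 2 ≤ (inner ℂ (u : H) (A u)).re

/-! ### The phase space -/

/-- The space `H¹`, the domain of `A^{1/2}`, to be normed by `‖u‖₁ = ‖A^{1/2} u‖`. -/
def HOne (A : H →ₗ.[ℂ] H) : Type _ := (sqrtOp A).domain

/-- The norm `‖u‖₁ = ‖A^{1/2} u‖`. -/
instance (A : H →ₗ.[ℂ] H) : SeminormedAddCommGroup (HOne A) :=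
  SeminormedAddCommGroup.induced (sqrtOp A).domain H (sqrtOp A).toFun

instance (A : H →ₗ.[ℂ] H) : Module ℂ (HOne A) :=
  inferInstanceAs (Module ℂ (sqrtOp A).domain)

instance (A : H →ₗ.[ℂ] H) : NormedSpace ℂ (HOne A) where
  norm_smul_le a u := by
    change ‖(sqrtOp A).toFun (a • (show (sqrtOp A).domain from u))‖ ≤
      ‖a‖ * ‖(sqrtOp A).toFun (show (sqrtOp A).domain from u)‖
    rw [map_smul, norm_smul]

/-- The inclusion of `H¹` in `H`. -/
def HOne.incl (A : H →ₗ.[ℂ] H) : HOne A →ₗ[ℂ] H := (sqrtOp A).domain.subtype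

/-- The phase space `H¹ × H` with norm `(‖u‖₁² + ‖v‖²)^{1/2}`. -/
abbrev PhaseSpace (A : H →ₗ.[ℂ] H) : Type _ := WithLp 2 (HOne A × H)

/-! ### The generator -/

/-- `A u + f(A) v = h` with `h ∈ H`, where `A u` and `f(A) v` are read in the dual spaces of `D(A)` and
`D(f(A))`: `⟨A w, u⟩ + ⟨f(A) w, v⟩ = ⟨w, h⟩` for all `w` in `D(A) ∩ D(f(A))`. -/
def IsWeakSum (A : H →ₗ.[ℂ] H) (f : realSpectrum A → ℝ) (u v h : H) : Prop :=
  ∀ (w : H) (hA : w ∈ A.domain) (hf : w ∈ (realCalculus A f).domain),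
    inner ℂ u (A ⟨w, hA⟩) + inner ℂ v (realCalculus A f ⟨w, hf⟩) = inner ℂ h w

/-- The graph of the generator: the pairs `((u, v), (u', v'))` in the square of the phase space with
`u' = v` (so that `v ∈ H¹`) and `A u + f(A) v = -v'` in `H`. -/
def generatorGraph (A : H →ₗ.[ℂ] H) (f : realSpectrum A → ℝ) :
    Submodule ℂ (PhaseSpace A × PhaseSpace A) where
  carrier := {p | HOne.incl A p.2.fst = p.1.snd ∧
    IsWeakSum A f (HOne.incl A p.1.fst) p.1.snd (-p.2.snd)}
  zero_mem' := by
    refine ⟨by simp, fun w _ _ => by simp⟩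
  add_mem' := by
    rintro p q ⟨hp1, hp2⟩ ⟨hq1, hq2⟩
    refine ⟨by simp [hp1, hq1], fun w hA hf => ?_⟩
    have h1 := hp2 w hA hf
    have h2 := hq2 w hA hf
    simp only [Prod.fst_add, Prod.snd_add, WithLp.add_fst, WithLp.add_snd, map_add, neg_add,
      inner_add_left]
    rw [← h1, ← h2]
    ring
  smul_mem' := by
    rintro c p ⟨hp1, hp2⟩
    refine ⟨by simp [hp1], fun w hA hf => ?_⟩
    have h1 := hp2 w hA hf
    simp only [Prod.smul_fst, Prod.smul_snd, WithLp.smul_fst, WithLp.smul_snd, map_smul, ← smul_neg,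
      inner_smul_left]
    rw [← h1]
    ring

/-- The operator `𝔸 (u, v) = (v, -A u - f(A) v)` on `H¹ × H`, with domain
`{(u, v) | v ∈ H¹, A u + f(A) v ∈ H}`. -/
def generator (A : H →ₗ.[ℂ] H) (f : realSpectrum A → ℝ) : PhaseSpace A →ₗ.[ℂ] PhaseSpace A :=
  (generatorGraph A f).toLinearPMap

/-! ### The sets in the description of the spectrum -/

/-- The root `ξ_s⁺` of `ξ² + a ξ + s = 0`, for `a = f(s)`. -/
def xiPlus (a s : ℝ) : ℂ :=
  if 2 * √s ≤ a then -(a : ℂ) / 2 + (√(a ^ 2 - 4 * s) : ℝ) / 2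
  else -(a : ℂ) / 2 + Complex.I * ((√(4 * s - a ^ 2) : ℝ) / 2)

/-- The root `ξ_s⁻` of `ξ² + a ξ + s = 0`, for `a = f(s)`. -/
def xiMinus (a s : ℝ) : ℂ :=
  if 2 * √s ≤ a then -(a : ℂ) / 2 - (√(a ^ 2 - 4 * s) : ℝ) / 2
  else -(a : ℂ) / 2 - Complex.I * ((√(4 * s - a ^ 2) : ℝ) / 2)

/-- The set `Λ` of positive limits of `f(s_n)/s_n` along sequences in the spectrum with `s_n → ∞`. -/
def limitSet (A : H →ₗ.[ℂ] H) (f : realSpectrum A → ℝ) : Set ℝ :=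
  {l | 0 < l ∧ ∃ s : ℕ → realSpectrum A, Tendsto (fun n => (s n : ℝ)) atTop atTop ∧
    Tendsto (fun n => f (s n) / (s n : ℝ)) atTop (𝓝 l)}

end DampedEvolution

end

/-!
The spectral theorem is extracted from the continuous functional calculus of the bounded operator
`A⁻¹`. In the coordinates `(A^{1/2} u, v)`, the equation `(ξ - 𝔸)(u, v) = (g, h)` then becomes a
pair of linear equations whose coefficients are functions of `A`, with determinant
`p ξ s = ξ² + f(s) ξ + s`. For `ξ ≠ 0` the entries of the inverse matrix are bounded on `σ(A)`
exactly when the quotient `p ξ s / (ξ + f(s)) = ξ + s / (ξ + f(s))` stays away from `0`; where it is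
small, the spectral projections of `A` provide approximate eigenvectors of `𝔸`. Finally, if the
quotient tends to `0` along a sequence in `σ(A)`, then a bounded subsequence accumulates at some `s`
with `p ξ s = 0`, whereas along a sequence `s → ∞` the limit says that `f(s) / s → -1 / ξ`.
-/

noncomputable section

namespace DampedEvolution

/-! ### Complex measures -/

section ComplexMeasure

variable {Ω : Type*} [MeasurableSpace Ω] {μ ν : ComplexMeasure Ω} {φ ψ : Ω → ℂ}

theorem variation_withDensity_mul (hφ : μ.Integrable φ) :
    (μ.withDensity φ (.mul ℝ ℂ)).variation = μ.variation.withDensity fun s => ‖φ s‖ₑ := by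
  rw [VectorMeasure.variation_withDensity hφ (by simp),
    VectorMeasure.variation_transpose_eq μ (.mul ℝ ℂ) (by simp)]

theorem integrable_mul_of_integrable_withDensity {m : Measure Ω} (hφ : Measurable φ)
    (hψ : Integrable ψ (m.withDensity fun s => ‖φ s‖ₑ)) : Integrable (fun s => ψ s * φ s) m := by
  have hnorm : Integrable (fun s => ‖φ s‖₊ • ψ s) m :=
    (integrable_withDensity_iff_integrable_smul₀ hφ.nnnorm.aemeasurable).1 hψ
  have hphase : Integrable (fun s => (φ s / ‖φ s‖) * (‖φ s‖₊ • ψ s)) m := by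
    refine hnorm.bdd_mul (c := 1)
      (hφ.div (by fun_prop)).aestronglyMeasurable (Eventually.of_forall fun s => ?_)
    rw [norm_div, Complex.norm_real, norm_norm]
    exact div_self_le_one _
  refine hphase.congr (Eventually.of_forall fun s => ?_)
  change φ s / ‖φ s‖ * ((‖φ s‖ : ℂ) * ψ s) = ψ s * φ s
  rcases eq_or_ne (φ s) 0 with h | h
  · simp [h]
  · have : (‖φ s‖ : ℂ) ≠ 0 := by simpa using h
    field_simp

theorem integral_const_mul_complexMeasure (c : ℂ) (hφ : μ.Integrable φ) :
    μ.integral (fun s => c * φ s) (.mul ℝ ℂ) = c * μ.integral φ (.mul ℝ ℂ) := by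
  have hcomm : ContinuousLinearMap.compL ℝ ℂ ℂ ℂ (.mul ℝ ℂ c) ∘L .mul ℝ ℂ =
      .mul ℝ ℂ ∘L .mul ℝ ℂ c := by
    refine ContinuousLinearMap.ext fun x => ContinuousLinearMap.ext fun y => ?_
    simp [mul_assoc]
  have h := VectorMeasure.continuousLinearMap_apply_integral
    (B := .mul ℝ ℂ) (C := ContinuousLinearMap.mul ℝ ℂ c) hφ
  rw [hcomm, ← VectorMeasure.integral_continuousLinearMap_comp hφ] at h
  exact h.symm

theorem integral_withDensity_mul_indicator_const (hφ : μ.Integrable φ) {ω : Set Ω}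
    (hω : MeasurableSet ω) (c : ℂ)
    (hfin : (μ.withDensity φ (.mul ℝ ℂ)).variation ω < ⊤) :
    (μ.withDensity φ (.mul ℝ ℂ)).integral (ω.indicator fun _ => c) (.mul ℝ ℂ) =
      μ.integral (fun s => ω.indicator (fun _ => c) s * φ s) (.mul ℝ ℂ) := by
  have : IsFiniteMeasure ((μ.withDensity φ (.mul ℝ ℂ)).variation.restrict ω) :=
    ⟨by simpa using hfin⟩
  rw [VectorMeasure.integral_indicator_const _ hω, VectorMeasure.withDensity_apply hφ,
    ← VectorMeasure.integral_indicator hω, ContinuousLinearMap.mul_apply',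
    ← integral_const_mul_complexMeasure c (hφ.indicator hω)]
  congr 1
  ext s
  by_cases hs : s ∈ ω <;> simp [hs]

theorem continuous_integral_mul (hφm : Measurable φ) (hφ : μ.Integrable φ) :
    Continuous fun χ : Ω →₁[(μ.withDensity φ (.mul ℝ ℂ)).variation] ℂ =>
      μ.integral (fun s => χ s * φ s) (.mul ℝ ℂ) := by
  have hvar := variation_withDensity_mul hφ
  have hint (χ : Ω →₁[(μ.withDensity φ (.mul ℝ ℂ)).variation] ℂ) :
      μ.Integrable fun s => χ s * φ s :=
    integrable_mul_of_integrable_withDensity hφm (hvar ▸ L1.integrable_coeFn χ)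
  have hlint (χ : Ω → ENNReal) (hχ : AEMeasurable χ (μ.withDensity φ (.mul ℝ ℂ)).variation) :
      ∫⁻ s, χ s ∂(μ.withDensity φ (.mul ℝ ℂ)).variation = ∫⁻ s, ‖φ s‖ₑ * χ s ∂μ.variation := by
    rw [hvar] at hχ ⊢
    exact lintegral_withDensity_eq_lintegral_mul₀' hφm.enorm.aemeasurable hχ
  refine LipschitzWith.continuous (K := ‖ContinuousLinearMap.mul ℝ ℂ‖₊) fun χ₁ χ₂ => ?_
  refine (VectorMeasure.edist_integral_le_lintegral_edist (hint χ₁) (hint χ₂)).trans ?_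
  gcongr
  · exact (enorm_eq_nnnorm _).le
  rw [L1.edist_def,
    hlint _ ((Lp.aestronglyMeasurable χ₁).edist (Lp.aestronglyMeasurable χ₂))]
  refine (lintegral_congr fun s => ?_).le
  rw [edist_eq_enorm_sub, edist_eq_enorm_sub, ← sub_mul, enorm_mul, mul_comm]

theorem integral_withDensity_mul (hφm : Measurable φ) (hφ : μ.Integrable φ)
    (hψ : (μ.withDensity φ (.mul ℝ ℂ)).Integrable ψ) :
    (μ.withDensity φ (.mul ℝ ℂ)).integral ψ (.mul ℝ ℂ) =
      μ.integral (fun s => ψ s * φ s) (.mul ℝ ℂ) := by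
  have hvar := variation_withDensity_mul hφ
  have hint {χ : Ω → ℂ} (hχ : (μ.withDensity φ (.mul ℝ ℂ)).Integrable χ) :
      μ.Integrable fun s => χ s * φ s :=
    integrable_mul_of_integrable_withDensity hφm (hvar ▸ hχ)
  refine hψ.induction (P := fun χ => (μ.withDensity φ (.mul ℝ ℂ)).integral χ (.mul ℝ ℂ) =
    μ.integral (fun s => χ s * φ s) (.mul ℝ ℂ)) ?_ ?_ ?_ ?_
  · exact fun c _ hω hfin => integral_withDensity_mul_indicator_const hφ hω c hfin
  · intro χ₁ χ₂ _ h₁ h₂ e₁ e₂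
    simp only [Pi.add_apply, add_mul]
    rw [VectorMeasure.integral_add h₁ h₂, e₁, e₂,
      VectorMeasure.integral_fun_add (hint h₁) (hint h₂)]
  · exact isClosed_eq VectorMeasure.continuous_integral (continuous_integral_mul hφm hφ)
  · intro χ₁ χ₂ h _ e
    rw [← VectorMeasure.integral_congr_ae h, e]
    rw [hvar, EventuallyEq, ae_withDensity_iff hφm.enorm] at h
    refine VectorMeasure.integral_congr_ae (h.mono fun s hs => ?_)
    rcases eq_or_ne (φ s) 0 with h0 | h0
    · simp [h0]
    · exact congrArg (· * φ s) (hs (by simpa using h0))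

theorem integral_smul_complexMeasure (c : ℂ) [IsFiniteMeasure μ.variation] (hφ : μ.Integrable φ) :
    (c • μ).integral φ (.mul ℝ ℂ) = c * μ.integral φ (.mul ℝ ℂ) := by
  have hc : μ.Integrable fun _ => c := integrable_const c
  have hμ : c • μ = μ.withDensity (fun _ => c) (.mul ℝ ℂ) := by
    ext1 ω _
    rw [VectorMeasure.withDensity_apply hc, VectorMeasure.setIntegral_const]
    rfl
  have hφc : (μ.withDensity (fun _ => c) (.mul ℝ ℂ)).Integrable φ := by
    rw [VectorMeasure.Integrable, variation_withDensity_mul hc, withDensity_const]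
    exact hφ.smul_measure (by simp)
  simp_rw [hμ, integral_withDensity_mul measurable_const hc hφc, mul_comm (φ _) c,
    integral_const_mul_complexMeasure c hφ]

theorem exists_measure_apply_eq_enorm (h : ∀ ω, MeasurableSet ω → μ ω = ‖μ ω‖) :
    ∃ m : Measure Ω, IsFiniteMeasure m ∧ ∀ ω, MeasurableSet ω → m ω = ‖μ ω‖ₑ := by
  have hre (ω : Set Ω) (hω : MeasurableSet ω) : ComplexMeasure.re μ ω = ‖μ ω‖ := by
    change (μ ω).re = ‖μ ω‖
    conv_lhs => rw [h ω hω, Complex.ofReal_re]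
  have hnonneg : VectorMeasure.restrict 0 Set.univ ≤
      VectorMeasure.restrict (ComplexMeasure.re μ) Set.univ := by
    refine VectorMeasure.restrict_le_restrict_of_subset_le _ _ fun ω hω _ => ?_
    rw [hre ω hω]
    exact norm_nonneg _
  refine ⟨SignedMeasure.toMeasureOfZeroLE _ Set.univ MeasurableSet.univ hnonneg, inferInstance,
    fun ω hω => ?_⟩
  rw [SignedMeasure.toMeasureOfZeroLE_apply _ hnonneg MeasurableSet.univ hω,
    ← ENNReal.ofReal_coe_nnreal, ← ofReal_norm]
  congr 1
  rw [← hre ω hω]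
  simp

theorem variation_apply_eq_enorm (h : ∀ ω, MeasurableSet ω → μ ω = ‖μ ω‖) {ω : Set Ω}
    (hω : MeasurableSet ω) : μ.variation ω = ‖μ ω‖ₑ := by
  obtain ⟨m, _, hm⟩ := exists_measure_apply_eq_enorm h
  have hle : μ.variation ≤ m :=
    VectorMeasure.variation_le_of_forall_enorm_le fun ω hω => (hm ω hω).ge
  exact le_antisymm ((hle ω).trans_eq (hm ω hω)) (VectorMeasure.enorm_measure_le_variation _ _)

theorem integral_eq_integral_variation (h : ∀ ω, MeasurableSet ω → μ ω = ‖μ ω‖) (φ : Ω → ℂ) :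
    μ.integral φ (.mul ℝ ℂ) = ∫ s, φ s ∂μ.variation := by
  rw [VectorMeasure.integral_eq_setToFun, MeasureTheory.integral_eq_setToFun]
  apply setToFun_congr_left' _ _ fun s hs _ => ?_
  ext
  simp only [VectorMeasure.transpose, weightedSMul, Measure.real, variation_apply_eq_enorm h hs,
    toReal_enorm, smul_apply, ContinuousLinearMap.id_apply,
    Complex.real_smul, ← h s hs]
  simp

theorem enorm_integral_le (φ : Ω → ℂ) :
    ‖μ.integral φ (.mul ℝ ℂ)‖ₑ ≤ ∫⁻ s, ‖φ s‖ₑ ∂μ.variation := by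
  have hmul : ‖ContinuousLinearMap.mul ℝ ℂ‖ₑ ≤ 1 := by
    rw [← ofReal_norm, ← ENNReal.ofReal_one]
    exact ENNReal.ofReal_le_ofReal (ContinuousLinearMap.opNorm_mul_le ℝ ℂ)
  exact VectorMeasure.enorm_integral_le_lintegral_enorm.trans (mul_le_of_le_one_left' hmul)

theorem variation_eq_of_apply_eq_conj
    (h : ∀ ω, MeasurableSet ω → μ ω = starRingEnd ℂ (ν ω)) : μ.variation = ν.variation := by
  have henorm (ω : Set Ω) (hω : MeasurableSet ω) : ‖μ ω‖ₑ = ‖ν ω‖ₑ := by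
    rw [h ω hω, RCLike.enorm_conj]
  refine le_antisymm (VectorMeasure.variation_le_of_forall_enorm_le fun ω hω => ?_)
    (VectorMeasure.variation_le_of_forall_enorm_le fun ω hω => ?_)
  · exact (henorm ω hω).trans_le (VectorMeasure.enorm_measure_le_variation _ _)
  · exact (henorm ω hω).symm.trans_le (VectorMeasure.enorm_measure_le_variation _ _)

theorem integral_conj_of_apply_eq_conj
    (h : ∀ ω, MeasurableSet ω → μ ω = starRingEnd ℂ (ν ω)) (hφ : ν.Integrable φ) :
    μ.integral (fun s => starRingEnd ℂ (φ s)) (.mul ℝ ℂ) =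
      starRingEnd ℂ (ν.integral φ (.mul ℝ ℂ)) := by
  have hvar := variation_eq_of_apply_eq_conj h
  have hφ' : μ.Integrable φ := by rwa [VectorMeasure.Integrable, hvar]
  have hconj := VectorMeasure.continuousLinearMap_apply_integral
    (B := ContinuousLinearMap.mul ℝ ℂ) (C := (Complex.conjCLE : ℂ →L[ℝ] ℂ)) hφ
  refine (VectorMeasure.integral_continuousLinearMap_comp (B := .mul ℝ ℂ)
    (C := (Complex.conjCLE : ℂ →L[ℝ] ℂ)) hφ').trans (Eq.trans ?_ hconj.symm)
  simp only [VectorMeasure.integral_eq_setToFun, hvar]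
  apply setToFun_congr_left' _ _ fun s hs _ => ContinuousLinearMap.ext fun x => ?_
  change starRingEnd ℂ x * μ s = starRingEnd ℂ (x * ν s)
  rw [h s hs, map_mul]

theorem lintegral_le_lintegral_sq_add {m ρ σ : Measure Ω}
    (h : ∀ c : NNReal, c • m ≤ c ^ 2 • ρ + σ) (φ : Ω → ENNReal) :
    ∫⁻ s, φ s ∂m ≤ ∫⁻ s, φ s ^ 2 ∂ρ + σ Set.univ := by
  rw [lintegral_eq_nnreal]
  refine iSup₂_le fun g hg => ?_
  calc (g.map (↑) : SimpleFunc Ω ENNReal).lintegral m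
      = ∑ c ∈ g.range, (c : ENNReal) * m (g ⁻¹' {c}) := g.map_lintegral _
    _ ≤ ∑ c ∈ g.range, ((c : ENNReal) ^ 2 * ρ (g ⁻¹' {c}) + σ (g ⁻¹' {c})) :=
        Finset.sum_le_sum fun c _ => by simpa using h c (g ⁻¹' {c})
    _ = ∫⁻ s, (g s : ENNReal) ^ 2 ∂ρ + σ Set.univ := by
        have hlint := (g.map fun c : NNReal => (c : ENNReal) ^ 2).lintegral_eq_lintegral ρ
        rw [SimpleFunc.map_lintegral] at hlint
        rw [Finset.sum_add_distrib, g.sum_range_measure_preimage_singleton, ← hlint]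
        rfl
    _ ≤ ∫⁻ s, φ s ^ 2 ∂ρ + σ Set.univ := by
        gcongr with s
        exact hg s

end ComplexMeasure

/-! ### Integration against a spectral measure -/

namespace SpectralMeasure

variable {H : Type*} [NormedAddCommGroup H] [InnerProductSpace ℂ H] [CompleteSpace H]
variable {Ω : Type*} [MeasurableSpace Ω]

section ScalarMeasures

variable (E : SpectralMeasure Ω H) {ω : Set Ω} (u v : H)

theorem measure_apply (hω : MeasurableSet ω) : E.measure u v ω = inner ℂ v (E.proj ω u) :=
  (E.exists_complexMeasure u v).choose_spec ω hω

theorem inner_proj_left (hω : MeasurableSet ω) :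
    inner ℂ (E.proj ω v) u = inner ℂ v (E.proj ω u) :=
  (E.isStarProjection ω hω).isSelfAdjoint.isSymmetric v u

theorem proj_proj (hω : MeasurableSet ω) : E.proj ω (E.proj ω u) = E.proj ω u :=
  DFunLike.congr_fun (E.isStarProjection ω hω).isIdempotentElem u

theorem inner_proj_proj (hω : MeasurableSet ω) :
    inner ℂ (E.proj ω v) (E.proj ω u) = inner ℂ v (E.proj ω u) := by
  rw [E.inner_proj_left _ _ hω, E.proj_proj u hω]

theorem measure_self_apply (hω : MeasurableSet ω) :
    E.measure u u ω = ((‖E.proj ω u‖ ^ 2 : ℝ) : ℂ) := by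
  rw [E.measure_apply u u hω, ← E.inner_proj_proj u u hω, inner_self_eq_norm_sq_to_K]
  push_cast
  rfl

theorem measure_self_apply_eq_norm (hω : MeasurableSet ω) :
    E.measure u u ω = ‖E.measure u u ω‖ := by
  rw [E.measure_self_apply u hω, Complex.norm_real, norm_pow, norm_norm]

/-- The positive measure `μ_{u,u}(ω) = ‖E(ω)u‖²`, which is its own total variation. -/
def diag : Measure Ω := (E.measure u u).variation

theorem diag_apply (hω : MeasurableSet ω) :
    E.diag u ω = ENNReal.ofReal (‖E.proj ω u‖ ^ 2) := by
  rw [diag, variation_apply_eq_enorm (fun _ => E.measure_self_apply_eq_norm u) hω,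
    E.measure_self_apply u hω, ← ofReal_norm, Complex.norm_real, norm_pow, norm_norm]

theorem diag_univ : E.diag u Set.univ = ENNReal.ofReal (‖u‖ ^ 2) := by
  rw [E.diag_apply u MeasurableSet.univ, E.proj_univ]
  rfl

instance : IsFiniteMeasure (E.diag u) := ⟨by rw [E.diag_univ]; exact ENNReal.ofReal_lt_top⟩

theorem integral_measure_self (φ : Ω → ℂ) :
    (E.measure u u).integral φ (.mul ℝ ℂ) = ∫ s, φ s ∂(E.diag u) :=
  integral_eq_integral_variation (fun _ => E.measure_self_apply_eq_norm u) φ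

theorem measure_add_left (u' : H) : E.measure (u + u') v = E.measure u v + E.measure u' v := by
  ext1 ω hω
  simp only [add_apply, E.measure_apply _ _ hω, map_add, inner_add_right]

theorem measure_add_right (v' : H) : E.measure u (v + v') = E.measure u v + E.measure u v' := by
  ext1 ω hω
  simp only [add_apply, E.measure_apply _ _ hω, inner_add_left]

theorem measure_smul_left (c : ℂ) : E.measure (c • u) v = c • E.measure u v := by
  ext1 ω hω
  simp only [smul_apply, E.measure_apply _ _ hω, map_smul, inner_smul_right, smul_eq_mul]

theorem measure_smul_right (c : ℂ) : E.measure u (c • v) = starRingEnd ℂ c • E.measure u v := by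
  ext1 ω hω
  simp only [smul_apply, E.measure_apply _ _ hω, inner_smul_left, smul_eq_mul]

theorem measure_proj_right (hω : MeasurableSet ω) :
    E.measure u (E.proj ω v) = (E.measure u v).restrict ω := by
  ext1 τ hτ
  rw [VectorMeasure.restrict_apply _ hω hτ, E.measure_apply _ _ hτ,
    E.measure_apply _ _ (hτ.inter hω), Set.inter_comm, E.proj_inter _ _ hω hτ,
    E.inner_proj_left _ _ hω]
  rfl

theorem measure_swap (hω : MeasurableSet ω) :
    E.measure u v ω = starRingEnd ℂ (E.measure v u ω) := by
  rw [E.measure_apply _ _ hω, E.measure_apply _ _ hω, inner_conj_symm, E.inner_proj_left _ _ hω]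

theorem variation_measure_le : (E.measure u v).variation ≤ E.diag u + E.diag v := by
  refine VectorMeasure.variation_le_of_forall_enorm_le fun ω hω => ?_
  rw [Measure.add_apply, E.diag_apply u hω, E.diag_apply v hω,
    ← ENNReal.ofReal_add (by positivity) (by positivity), ← ofReal_norm, E.measure_apply _ _ hω,
    ← E.inner_proj_proj _ _ hω]
  refine ENNReal.ofReal_le_ofReal ((norm_inner_le_norm _ _).trans ?_)
  nlinarith [sq_nonneg (‖E.proj ω u‖ - ‖E.proj ω v‖), sq_nonneg ‖E.proj ω u‖,
    sq_nonneg ‖E.proj ω v‖]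

instance : IsFiniteMeasure (E.measure u v).variation :=
  isFiniteMeasure_of_le _ (E.variation_measure_le u v)

theorem diag_smul (c : ℂ) : E.diag (c • u) = ‖c‖ₑ ^ 2 • E.diag u := by
  ext ω hω
  rw [Measure.smul_apply, E.diag_apply _ hω, E.diag_apply _ hω, map_smul, norm_smul, mul_pow,
    ENNReal.ofReal_mul (by positivity), smul_eq_mul, ENNReal.ofReal_pow (norm_nonneg _),
    ofReal_norm]

theorem diag_add_le : E.diag (u + v) ≤ (2 : ENNReal) • (E.diag u + E.diag v) := by
  refine Measure.le_iff.2 fun ω hω => ?_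
  rw [Measure.smul_apply, Measure.add_apply, E.diag_apply _ hω, E.diag_apply _ hω,
    E.diag_apply _ hω, ← ENNReal.ofReal_add (by positivity) (by positivity), smul_eq_mul,
    ← ENNReal.ofReal_ofNat 2, ← ENNReal.ofReal_mul (by norm_num), map_add]
  refine ENNReal.ofReal_le_ofReal ?_
  nlinarith [norm_add_le (E.proj ω u) (E.proj ω v), sq_nonneg (‖E.proj ω u‖ - ‖E.proj ω v‖),
    norm_nonneg (E.proj ω u + E.proj ω v)]

theorem lintegral_variation_measure_le (φ : Ω → ENNReal) :
    ∫⁻ s, φ s ∂(E.measure u v).variation ≤ ∫⁻ s, φ s ^ 2 ∂(E.diag u) + E.diag v Set.univ := by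
  refine lintegral_le_lintegral_sq_add (fun c => ?_) φ
  have h := E.variation_measure_le ((c : ℂ) • u) v
  have hc : ‖(c : ℂ)‖₊ = c := by ext; simp
  rw [E.measure_smul_left, VectorMeasure.variation_smul, E.diag_smul, enorm_eq_nnnorm, hc] at h
  exact_mod_cast h

end ScalarMeasures

section HasIntegral

variable {E : SpectralMeasure Ω H} {φ ψ : Ω → ℂ} {u u' v w w' z : H}

theorem lintegral_enorm_sq_lt_top (h : Integrable (fun s => ‖φ s‖ ^ 2) (E.diag u)) :
    ∫⁻ s, ‖φ s‖ₑ ^ 2 ∂(E.diag u) < ⊤ := by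
  simpa [HasFiniteIntegral] using h.2

theorem integrable_measure (hφ : Measurable φ) (h : Integrable (fun s => ‖φ s‖ ^ 2) (E.diag u))
    (v : H) : (E.measure u v).Integrable φ :=
  ⟨hφ.aestronglyMeasurable, (E.lintegral_variation_measure_le u v _).trans_lt
    (ENNReal.add_lt_top.2 ⟨lintegral_enorm_sq_lt_top h, measure_lt_top _ _⟩)⟩

variable (E φ u w) in
/-- The pair `(u, w)` belongs to the graph of `∫ φ dE`. Working with graphs avoids carrying domain
proofs through compositions of unbounded operators. -/
def HasIntegral : Prop :=
  Integrable (fun s => ‖φ s‖ ^ 2) (E.diag u) ∧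
    ∀ v, inner ℂ v w = (E.measure u v).integral φ (.mul ℝ ℂ)

theorem HasIntegral.unique (h : E.HasIntegral φ u w) (h' : E.HasIntegral φ u w') : w = w' :=
  ext_inner_left ℂ fun v => by rw [h.2, h'.2]

theorem exists_hasIntegral (hφ : Measurable φ) (h : Integrable (fun s => ‖φ s‖ ^ 2) (E.diag u)) :
    ∃ w, E.HasIntegral φ u w := by
  have hint := integrable_measure hφ h
  let ℓ : H →ₗ[ℂ] ℂ :=
    { toFun v := starRingEnd ℂ ((E.measure u v).integral φ (.mul ℝ ℂ))
      map_add' v v' := by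
        rw [E.measure_add_right,
          VectorMeasure.integral_add_vectorMeasure (hint v) (hint v'), map_add]
      map_smul' c v := by
        rw [E.measure_smul_right, integral_smul_complexMeasure _ (hint v), map_mul,
          Complex.conj_conj]
        rfl }
  let K : ENNReal := ∫⁻ s, ‖φ s‖ₑ ^ 2 ∂(E.diag u) + 1
  have hK : K ≠ ⊤ := (ENNReal.add_lt_top.2 ⟨lintegral_enorm_sq_lt_top h, ENNReal.one_lt_top⟩).ne
  have hsphere (v : H) (hv : ‖v‖ = 1) : ‖ℓ v‖ ≤ K.toReal := by
    change ‖starRingEnd ℂ _‖ ≤ K.toReal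
    rw [RCLike.norm_conj, ← toReal_enorm]
    refine ENNReal.toReal_mono hK ((enorm_integral_le φ).trans ?_)
    refine (E.lintegral_variation_measure_le u v _).trans_eq ?_
    rw [E.diag_univ, hv, one_pow, ENNReal.ofReal_one]
  have hbound (v : H) : ‖ℓ v‖ ≤ K.toReal * ‖v‖ := by
    simpa using LinearMap.bound_of_sphere_bound one_pos K.toReal ℓ
      (fun v hv => hsphere v (by simpa using hv)) v
  refine ⟨(InnerProductSpace.toDual ℂ H).symm (ℓ.mkContinuous _ hbound), h, fun v => ?_⟩
  rw [← inner_conj_symm, InnerProductSpace.toDual_symm_apply]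
  exact Complex.conj_conj _

theorem HasIntegral.add_vec (hφ : Measurable φ) (h : E.HasIntegral φ u w)
    (h' : E.HasIntegral φ u' w') : E.HasIntegral φ (u + u') (w + w') := by
  refine ⟨?_, fun v => ?_⟩
  · exact ((h.1.add_measure h'.1).smul_measure (by simp)).mono_measure (E.diag_add_le u u')
  · rw [inner_add_right, h.2, h'.2, E.measure_add_left, VectorMeasure.integral_add_vectorMeasure
      (integrable_measure hφ h.1 v) (integrable_measure hφ h'.1 v)]

theorem HasIntegral.smul_vec (hφ : Measurable φ) (h : E.HasIntegral φ u w) (c : ℂ) :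
    E.HasIntegral φ (c • u) (c • w) := by
  refine ⟨?_, fun v => ?_⟩
  · rw [E.diag_smul]
    exact h.1.smul_measure (by simp)
  · rw [inner_smul_right, h.2, E.measure_smul_left,
      integral_smul_complexMeasure _ (integrable_measure hφ h.1 v)]

theorem HasIntegral.zero_vec (hφ : Measurable φ) : E.HasIntegral φ 0 0 := by
  have hdiag : E.diag (0 : H) = 0 := by
    rw [← Measure.measure_univ_eq_zero, E.diag_univ]
    simp
  obtain ⟨w, hw⟩ := exists_hasIntegral (E := E) (u := 0) hφ (hdiag ▸ integrable_zero_measure)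
  simpa using hw.smul_vec hφ 0

theorem HasIntegral.add (hφ : Measurable φ) (hψ : Measurable ψ) (h : E.HasIntegral φ u w)
    (h' : E.HasIntegral ψ u z) : E.HasIntegral (φ + ψ) u (w + z) := by
  refine ⟨?_, fun v => ?_⟩
  · refine Integrable.mono' ((h.1.add h'.1).const_mul 2) (by fun_prop)
      (Eventually.of_forall fun s => ?_)
    rw [Real.norm_of_nonneg (by positivity)]
    simp only [Pi.add_apply]
    nlinarith [norm_add_le (φ s) (ψ s), sq_nonneg (‖φ s‖ - ‖ψ s‖), norm_nonneg (φ s + ψ s)]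
  · rw [inner_add_right, h.2, h'.2, VectorMeasure.integral_add
      (integrable_measure hφ h.1 v) (integrable_measure hψ h'.1 v)]

theorem HasIntegral.const_mul (hφ : Measurable φ) (h : E.HasIntegral φ u w) (c : ℂ) :
    E.HasIntegral (c • φ) u (c • w) := by
  refine ⟨?_, fun v => ?_⟩
  · simp_rw [Pi.smul_apply, norm_smul, mul_pow]
    exact h.1.const_mul _
  · rw [inner_smul_right, h.2,
      ← integral_const_mul_complexMeasure _ (integrable_measure hφ h.1 v)]
    rfl

theorem HasIntegral.measure_eq (hφ : Measurable φ) (h : E.HasIntegral φ u w) (v : H) :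
    E.measure w v = (E.measure u v).withDensity φ (.mul ℝ ℂ) := by
  ext1 ω hω
  rw [E.measure_apply _ _ hω, VectorMeasure.withDensity_apply (integrable_measure hφ h.1 v),
    ← E.inner_proj_left _ _ hω, h.2, E.measure_proj_right _ _ hω]

theorem HasIntegral.variation_eq (hφ : Measurable φ) (h : E.HasIntegral φ u w) (v : H) :
    (E.measure w v).variation = (E.measure u v).variation.withDensity fun s => ‖φ s‖ₑ := by
  rw [h.measure_eq hφ, variation_withDensity_mul (integrable_measure hφ h.1 v)]

theorem HasIntegral.diag_eq (hφ : Measurable φ) (h : E.HasIntegral φ u w) :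
    E.diag w = (E.diag u).withDensity fun s => ‖φ s‖ₑ ^ 2 := by
  rw [diag, h.variation_eq hφ,
    variation_eq_of_apply_eq_conj fun _ hω => E.measure_swap u w hω, h.variation_eq hφ,
    ← withDensity_mul _ hφ.enorm hφ.enorm]
  congr 1
  ext s
  simp [sq]

theorem HasIntegral.integrable_iff (hφ : Measurable φ) (h : E.HasIntegral φ u w) :
    Integrable (fun s => ‖ψ s‖ ^ 2) (E.diag w) ↔
      Integrable (fun s => ‖(ψ * φ) s‖ ^ 2) (E.diag u) := by
  have hcoe : (fun s => ‖φ s‖ₑ ^ 2) = fun s => ((‖φ s‖₊ ^ 2 : NNReal) : ENNReal) := by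
    ext s
    rw [enorm_eq_nnnorm, ENNReal.coe_pow]
  rw [h.diag_eq hφ, hcoe, integrable_withDensity_iff_integrable_smul₀ (by fun_prop)]
  refine integrable_congr (Eventually.of_forall fun s => ?_)
  change ‖φ s‖ ^ 2 * ‖ψ s‖ ^ 2 = ‖ψ s * φ s‖ ^ 2
  rw [norm_mul, mul_pow, mul_comm]

theorem HasIntegral.hasIntegral_iff_mul (hφ : Measurable φ) (hψ : Measurable ψ)
    (h : E.HasIntegral φ u w) : E.HasIntegral ψ w z ↔ E.HasIntegral (ψ * φ) u z := by
  rw [HasIntegral, HasIntegral, ← h.integrable_iff hφ]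
  refine and_congr_right fun hw => forall_congr' fun v => ?_
  have hint := integrable_measure hψ hw v
  rw [h.measure_eq hφ] at hint ⊢
  rw [integral_withDensity_mul hφ (integrable_measure hφ h.1 v) hint]
  rfl

theorem HasIntegral.norm_le (hφ : Measurable φ) (h : E.HasIntegral φ u w) {C : ℝ} (hC : 0 ≤ C)
    (hb : ∀ s, ‖φ s‖ ≤ C) : ‖w‖ ≤ C * ‖u‖ := by
  have hsq : ENNReal.ofReal (‖w‖ ^ 2) ≤ ENNReal.ofReal ((C * ‖u‖) ^ 2) := by
    rw [← E.diag_univ, h.diag_eq hφ, withDensity_apply _ MeasurableSet.univ, setLIntegral_univ,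
      mul_pow, ENNReal.ofReal_mul (by positivity), ← E.diag_univ u, ← lintegral_const]
    gcongr with s
    rw [← ofReal_norm, ← ENNReal.ofReal_pow (norm_nonneg _)]
    exact ENNReal.ofReal_le_ofReal (pow_le_pow_left₀ (norm_nonneg _) (hb s) 2)
  rw [ENNReal.ofReal_le_ofReal_iff (by positivity)] at hsq
  exact le_of_sq_le_sq hsq (by positivity)

theorem HasIntegral.le_norm (hφ : Measurable φ) (h : E.HasIntegral φ u w) {ω : Set Ω}
    (hω : MeasurableSet ω) (hnull : E.proj ω = 0) {δ : ℝ} (hδ : 0 ≤ δ)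
    (hb : ∀ s ∉ ω, δ ≤ ‖φ s‖) : δ * ‖u‖ ≤ ‖w‖ := by
  have hdiag : E.diag u ω = 0 := by simp [E.diag_apply u hω, hnull]
  have hsq : ENNReal.ofReal ((δ * ‖u‖) ^ 2) ≤ ENNReal.ofReal (‖w‖ ^ 2) := by
    rw [← E.diag_univ w, h.diag_eq hφ, withDensity_apply _ .univ, setLIntegral_univ,
      mul_pow, ENNReal.ofReal_mul (by positivity), ← E.diag_univ u, ← lintegral_const]
    refine lintegral_mono_ae ?_
    filter_upwards [compl_mem_ae_iff.2 hdiag] with s hs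
    rw [ENNReal.ofReal_pow hδ, ← ofReal_norm]
    gcongr
    exact hb s hs
  exact le_of_sq_le_sq ((ENNReal.ofReal_le_ofReal_iff (by positivity)).1 hsq) (norm_nonneg _)

theorem hasIntegral_indicator_one {ω : Set Ω} (hω : MeasurableSet ω) (u : H) :
    E.HasIntegral (ω.indicator 1) u (E.proj ω u) := by
  refine ⟨?_, fun v => ?_⟩
  · refine Integrable.of_bound (C := 1)
      ((measurable_one.indicator hω).norm.pow_const 2).aestronglyMeasurable
      (Eventually.of_forall fun s => ?_)
    by_cases hs : s ∈ ω <;> simp [hs]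
  · rw [show ω.indicator (1 : Ω → ℂ) = ω.indicator fun _ => 1 from rfl,
      VectorMeasure.integral_indicator_const _ hω, ContinuousLinearMap.mul_apply', one_mul,
      E.measure_apply _ _ hω]

theorem HasIntegral.inner_eq (hφ : Measurable φ) (h : E.HasIntegral φ u w)
    (h' : E.HasIntegral (star φ) v z) : inner ℂ v w = inner ℂ z u := by
  rw [← inner_conj_symm z u, h'.2, h.2]
  change _ = starRingEnd ℂ ((E.measure v u).integral (fun s => starRingEnd ℂ (φ s)) _)
  rw [integral_conj_of_apply_eq_conj (fun ω hω => E.measure_swap v u hω)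
    (integrable_measure hφ h.1 v), Complex.conj_conj]

theorem IsIntegral.mem_graph_iff {T : H →ₗ.[ℂ] H} (hT : E.IsIntegral φ T) :
    (u, w) ∈ T.graph ↔ E.HasIntegral φ u w := by
  constructor
  · intro h
    obtain ⟨x, rfl, rfl⟩ := T.mem_graph_iff.1 h
    exact ⟨(hT.1 x).1 x.2, hT.2 x⟩
  · intro h
    have hu : u ∈ T.domain := (hT.1 u).2 h.1
    exact T.mem_graph_iff.2 ⟨⟨u, hu⟩, rfl, HasIntegral.unique ⟨h.1, hT.2 ⟨u, hu⟩⟩ h⟩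

theorem isIntegral_of_forall_mem_graph_iff {T : H →ₗ.[ℂ] H} (hφ : Measurable φ)
    (hT : ∀ u w, (u, w) ∈ T.graph ↔ E.HasIntegral φ u w) : E.IsIntegral φ T := by
  refine ⟨fun u => ⟨fun hu => ?_, fun hu => ?_⟩, fun u v => ?_⟩
  · exact ((hT _ _).1 (T.mem_graph ⟨u, hu⟩)).1
  · obtain ⟨w, hw⟩ := exists_hasIntegral hφ hu
    exact T.mem_domain_of_mem_graph ((hT _ _).2 hw)
  · exact ((hT _ _).1 (T.mem_graph u)).2 v

variable (E) in
theorem isIntegral_integral (hφ : Measurable φ) : E.IsIntegral φ (E.integral φ) := by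
  let g : Submodule ℂ (H × H) :=
    { carrier := {p | E.HasIntegral φ p.1 p.2}
      zero_mem' := .zero_vec hφ
      add_mem' := fun hp hq => HasIntegral.add_vec hφ hp hq
      smul_mem' := fun c _ hp => HasIntegral.smul_vec hφ hp c }
  have hg : ∀ x ∈ g, x.1 = 0 → x.2 = 0 := by
    rintro ⟨x, y⟩ hx rfl
    exact HasIntegral.unique hx (.zero_vec hφ)
  have hexists : ∃ T, E.IsIntegral φ T := ⟨g.toLinearPMap, isIntegral_of_forall_mem_graph_iff hφ
    fun u w => by rw [Submodule.toLinearPMap_graph_eq g hg]; rfl⟩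
  exact Classical.epsilon_spec hexists

theorem mem_graph_integral_iff (hφ : Measurable φ) :
    (u, w) ∈ (E.integral φ).graph ↔ E.HasIntegral φ u w :=
  (E.isIntegral_integral hφ).mem_graph_iff

end HasIntegral

end SpectralMeasure

/-! ### The bounded functional calculus -/

section BoundedMeasurable

variable {Ω Ω' : Type*} [MeasurableSpace Ω] [MeasurableSpace Ω']

variable (Ω) in
/-- The star algebra of bounded measurable functions, the domain of the bounded functional
calculus. -/
def boundedMeasurable : StarSubalgebra ℂ (Ω → ℂ) where
  carrier := {φ | Measurable φ ∧ ∃ C : ℝ, ∀ s, ‖φ s‖ ≤ C}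
  mul_mem' := by
    rintro φ ψ ⟨hφ, C, hC⟩ ⟨hψ, D, hD⟩
    refine ⟨hφ.mul hψ, C * D, fun s => ?_⟩
    rw [Pi.mul_apply, norm_mul]
    exact mul_le_mul (hC s) (hD s) (norm_nonneg _) ((norm_nonneg _).trans (hC s))
  add_mem' := by
    rintro φ ψ ⟨hφ, C, hC⟩ ⟨hψ, D, hD⟩
    exact ⟨hφ.add hψ, C + D, fun s => (norm_add_le _ _).trans (add_le_add (hC s) (hD s))⟩
  algebraMap_mem' c := ⟨measurable_const, ‖c‖, fun _ => le_rfl⟩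
  star_mem' := by
    rintro φ ⟨hφ, C, hC⟩
    exact ⟨continuous_star.measurable.comp hφ, C, fun s => (norm_star (φ s)).trans_le (hC s)⟩

theorem mem_boundedMeasurable {φ : Ω → ℂ} (hφ : Measurable φ) {C : ℝ} (h : ∀ s, ‖φ s‖ ≤ C) :
    φ ∈ boundedMeasurable Ω := ⟨hφ, C, h⟩

theorem indicator_one_mem_boundedMeasurable {ω : Set Ω} (hω : MeasurableSet ω) :
    ω.indicator 1 ∈ boundedMeasurable Ω := by
  refine mem_boundedMeasurable (C := 1) (measurable_one.indicator hω) fun s => ?_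
  by_cases hs : s ∈ ω <;> simp [hs]

theorem comp_mem_boundedMeasurable {τ : Ω → Ω'} (hτ : Measurable τ) (φ : boundedMeasurable Ω') :
    φ ∘ τ ∈ boundedMeasurable Ω :=
  ⟨φ.2.1.comp hτ, φ.2.2.imp fun _ hC s => hC (τ s)⟩

end BoundedMeasurable

theorem ext_inner_self {H : Type*} [NormedAddCommGroup H] [InnerProductSpace ℂ H]
    {S T : H →L[ℂ] H} (h : ∀ u, inner ℂ u (S u) = inner ℂ u (T u)) : S = T := by
  refine ContinuousLinearMap.coe_injective ((ext_inner_map _ _).1 fun u => ?_)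
  simpa only [inner_conj_symm, ContinuousLinearMap.coe_coe] using congrArg (starRingEnd ℂ) (h u)

namespace SpectralMeasure

variable {H : Type*} [NormedAddCommGroup H] [InnerProductSpace ℂ H] [CompleteSpace H]
variable {Ω Ω' : Type*} [MeasurableSpace Ω] [MeasurableSpace Ω']

section Calculus

variable (E : SpectralMeasure Ω H)

theorem hasIntegral_one (u : H) : E.HasIntegral 1 u u := by
  simpa [E.proj_univ] using hasIntegral_indicator_one (E := E) MeasurableSet.univ u

theorem exists_forall_hasIntegral (φ : boundedMeasurable Ω) :
    ∃ T : H →L[ℂ] H, ∀ u, E.HasIntegral φ u (T u) := by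
  obtain ⟨hφ, C, hC⟩ := φ.2
  have hsq (u : H) : Integrable (fun s => ‖φ.1 s‖ ^ 2) (E.diag u) := by
    refine Integrable.of_bound (C := C ^ 2) (by fun_prop) (Eventually.of_forall fun s => ?_)
    rw [Real.norm_of_nonneg (by positivity)]
    exact pow_le_pow_left₀ (norm_nonneg _) (hC s) 2
  choose T hT using fun u => exists_hasIntegral hφ (hsq u)
  let T' : H →ₗ[ℂ] H :=
    { toFun := T
      map_add' u v := (hT (u + v)).unique ((hT u).add_vec hφ (hT v))
      map_smul' c u := (hT (c • u)).unique ((hT u).smul_vec hφ c) }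
  exact ⟨T'.mkContinuous |C| fun u => (hT u).norm_le hφ (abs_nonneg C)
    fun s => (hC s).trans (le_abs_self C), hT⟩

/-- The bounded functional calculus `φ ↦ ∫ φ dE`. -/
def calculus : boundedMeasurable Ω →⋆ₐ[ℂ] (H →L[ℂ] H) :=
  let T (φ : boundedMeasurable Ω) := (E.exists_forall_hasIntegral φ).choose
  have hT (φ : boundedMeasurable Ω) (u : H) : E.HasIntegral φ u (T φ u) :=
    (E.exists_forall_hasIntegral φ).choose_spec u
  have hconst (c : ℂ) : T (algebraMap ℂ _ c) = algebraMap ℂ _ c := by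
    ext u
    refine (hT _ u).unique ?_
    simpa [Algebra.algebraMap_eq_smul_one] using
      (E.hasIntegral_one u).const_mul measurable_one c
  { toFun := T
    map_one' := by simpa using hconst 1
    map_mul' φ ψ := by
      ext u
      exact (hT _ u).unique (((hT ψ u).hasIntegral_iff_mul ψ.2.1 φ.2.1).1 (hT φ _))
    map_zero' := by simpa using hconst 0
    map_add' φ ψ := by
      ext u
      exact (hT _ u).unique ((hT φ u).add φ.2.1 ψ.2.1 (hT ψ u))
    commutes' := hconst
    map_star' φ := by
      rw [ContinuousLinearMap.star_eq_adjoint, ContinuousLinearMap.eq_adjoint_iff]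
      exact fun u v => ((hT φ v).inner_eq φ.2.1 (hT (star φ) u)).symm }

theorem hasIntegral_calculus (φ : boundedMeasurable Ω) (u : H) :
    E.HasIntegral φ u (E.calculus φ u) :=
  (E.exists_forall_hasIntegral φ).choose_spec u

theorem calculus_mul_apply (φ ψ : boundedMeasurable Ω) (u : H) :
    E.calculus (φ * ψ) u = E.calculus φ (E.calculus ψ u) := by
  rw [map_mul, mul_apply_eq_comp]

theorem inner_calculus_left (φ : boundedMeasurable Ω) (u v : H) :
    inner ℂ (E.calculus φ u) v = inner ℂ u (E.calculus (star φ) v) := by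
  rw [map_star, ContinuousLinearMap.star_eq_adjoint, ContinuousLinearMap.adjoint_inner_right]

theorem norm_calculus_apply_le (φ : boundedMeasurable Ω) {C : ℝ} (hC : 0 ≤ C)
    (h : ∀ s, ‖φ.1 s‖ ≤ C) (u : H) : ‖E.calculus φ u‖ ≤ C * ‖u‖ :=
  (E.hasIntegral_calculus φ u).norm_le φ.2.1 hC h

theorem calculus_indicator_one {ω : Set Ω} (hω : MeasurableSet ω) :
    E.calculus ⟨_, indicator_one_mem_boundedMeasurable hω⟩ = E.proj ω := by
  ext u
  exact (E.hasIntegral_calculus _ u).unique (hasIntegral_indicator_one hω u)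

theorem inner_calculus_self (φ : boundedMeasurable Ω) (u : H) :
    inner ℂ u (E.calculus φ u) = ∫ s, φ.1 s ∂(E.diag u) := by
  rw [(E.hasIntegral_calculus φ u).2, E.integral_measure_self]

theorem calculus_eq_of_forall_integral_eq {E' : SpectralMeasure Ω' H} {φ : boundedMeasurable Ω}
    {ψ : boundedMeasurable Ω'} (h : ∀ u, ∫ s, φ.1 s ∂(E.diag u) = ∫ s, ψ.1 s ∂(E'.diag u)) :
    E.calculus φ = E'.calculus ψ :=
  ext_inner_self fun u => by rw [inner_calculus_self, h, inner_calculus_self]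

theorem calculus_congr {φ ψ : boundedMeasurable Ω} {ω : Set Ω} (hω : MeasurableSet ω)
    (hnull : E.proj ω = 0) (h : ∀ s ∉ ω, φ.1 s = ψ.1 s) : E.calculus φ = E.calculus ψ := by
  refine calculus_eq_of_forall_integral_eq E fun u => integral_congr_ae ?_
  have hdiag : E.diag u ω = 0 := by simp [E.diag_apply u hω, hnull]
  filter_upwards [compl_mem_ae_iff.2 hdiag] with s hs using h s hs

theorem hasIntegral_inv_iff {φ : boundedMeasurable Ω} (hφ : ∀ s, φ.1 s ≠ 0) {u w : H} :
    E.HasIntegral (φ : Ω → ℂ)⁻¹ u w ↔ u = E.calculus φ w := by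
  have hinv : Measurable (φ : Ω → ℂ)⁻¹ := φ.2.1.inv
  constructor
  · intro h
    have hmul := (h.hasIntegral_iff_mul hinv φ.2.1).1 (E.hasIntegral_calculus φ w)
    rw [show (φ : Ω → ℂ) * (φ : Ω → ℂ)⁻¹ = 1 from funext fun s => mul_inv_cancel₀ (hφ s)] at hmul
    exact (E.hasIntegral_one u).unique hmul
  · rintro rfl
    rw [(E.hasIntegral_calculus φ w).hasIntegral_iff_mul φ.2.1 hinv,
      show (φ : Ω → ℂ)⁻¹ * (φ : Ω → ℂ) = 1 from funext fun s => inv_mul_cancel₀ (hφ s)]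
    exact E.hasIntegral_one w

theorem calculus_injective {φ : boundedMeasurable Ω} (hφ : ∀ s, φ.1 s ≠ 0) :
    Function.Injective (E.calculus φ) := fun _ _ h =>
  ((E.hasIntegral_inv_iff hφ).2 rfl).unique ((E.hasIntegral_inv_iff hφ).2 h)

end Calculus

section Map

variable (E : SpectralMeasure Ω H) {τ : Ω → Ω'} (hτ : Measurable τ)

/-- The image of a spectral measure under a measurable map. -/
def map : SpectralMeasure Ω' H where
  proj ω := E.proj (τ ⁻¹' ω)
  isStarProjection _ hω := E.isStarProjection _ (hτ hω)
  proj_empty := E.proj_empty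
  proj_univ := E.proj_univ
  proj_inter _ _ h₁ h₂ := E.proj_inter _ _ (hτ h₁) (hτ h₂)
  proj_union _ _ h₁ h₂ h := E.proj_union _ _ (hτ h₁) (hτ h₂)
    (congrArg (τ ⁻¹' ·) h)
  exists_complexMeasure u v := ⟨(E.measure u v).map τ, fun ω hω => by
    rw [VectorMeasure.map_apply _ hτ hω, E.measure_apply _ _ (hτ hω)]⟩

theorem diag_map (u : H) : (E.map hτ).diag u = (E.diag u).map τ := by
  ext ω hω
  rw [Measure.map_apply hτ hω, diag_apply _ _ hω, diag_apply _ _ (hτ hω)]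
  rfl

theorem calculus_map (φ : boundedMeasurable Ω') :
    (E.map hτ).calculus φ = E.calculus ⟨_, comp_mem_boundedMeasurable hτ φ⟩ := by
  refine calculus_eq_of_forall_integral_eq _ fun u => ?_
  rw [E.diag_map hτ, integral_map hτ.aemeasurable φ.2.1.aestronglyMeasurable]
  rfl

end Map

end SpectralMeasure

/-! ### The spectral measure of a representation of `C(X)` -/

section Construction

variable {H : Type*} [NormedAddCommGroup H] [InnerProductSpace ℂ H]

theorem inner_self_eq_ofReal (u : H) : inner ℂ u u = ((‖u‖ ^ 2 : ℝ) : ℂ) :=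
  (inner_self_eq_norm_sq_to_K u).trans (Complex.ofReal_pow _ _).symm

variable {Ω : Type*} [MeasurableSpace Ω] {P : Set Ω → H →L[ℂ] H} {m : H → Measure Ω}
  [∀ u, IsFiniteMeasure (m u)]

theorem exists_complexMeasure_of_inner_self
    (hm : ∀ u ω, MeasurableSet ω → inner ℂ u (P ω u) = ((m u).real ω : ℂ)) (u v : H) :
    ∃ μ : ComplexMeasure Ω, ∀ ω, MeasurableSet ω → μ ω = inner ℂ v (P ω u) := by
  let κ (x : H) : ComplexMeasure Ω := (m x).toSignedMeasure.toComplexMeasure 0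
  have hκ (x : H) (ω : Set Ω) (hω : MeasurableSet ω) : κ x ω = inner ℂ x (P ω x) := by
    rw [hm x ω hω, SignedMeasure.toComplexMeasure_apply,
      Measure.toSignedMeasure_apply_measurable hω]
    rfl
  refine ⟨(1 / 4 : ℂ) • (κ (u + v) - κ (u - v) + Complex.I • κ (u + Complex.I • v) -
    Complex.I • κ (u - Complex.I • v)), fun ω hω => ?_⟩
  simp only [smul_apply, sub_apply, add_apply, hκ _ ω hω, smul_eq_mul, map_add, map_sub, map_smul,
    inner_add_left, inner_add_right, inner_sub_left, inner_sub_right, inner_smul_left,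
    inner_smul_right, Complex.conj_I]
  linear_combination (1 / 2 * inner ℂ u (P ω v) - 1 / 2 * inner ℂ v (P ω u)) * Complex.I_sq

variable [CompleteSpace H]

/-- The spectral measure formed by a multiplicative family of projections `P ω` whose diagonal
matrix elements are finite positive measures. -/
def SpectralMeasure.ofMeasures (hP : ∀ ω, MeasurableSet ω → IsStarProjection (P ω))
    (hm : ∀ u ω, MeasurableSet ω → inner ℂ u (P ω u) = ((m u).real ω : ℂ))
    (huniv : ∀ u, (m u).real Set.univ = ‖u‖ ^ 2)
    (hinter : ∀ ω₁ ω₂, MeasurableSet ω₁ → MeasurableSet ω₂ → P (ω₁ ∩ ω₂) = P ω₁ * P ω₂) :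
    SpectralMeasure Ω H where
  proj := P
  isStarProjection := hP
  proj_empty := ext_inner_self fun u => by simp [hm u ∅ MeasurableSet.empty]
  proj_univ := ext_inner_self fun u => by
    rw [hm u _ MeasurableSet.univ, huniv, one_apply_eq_self, inner_self_eq_ofReal]
  proj_inter := hinter
  proj_union ω₁ ω₂ h₁ h₂ h := ext_inner_self fun u => by
    rw [hm u _ (h₁.union h₂), add_apply, inner_add_right, hm u _ h₁, hm u _ h₂,
      measureReal_union (Set.disjoint_iff_inter_eq_empty.2 h) h₂, Complex.ofReal_add]
  exists_complexMeasure := exists_complexMeasure_of_inner_self hm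

theorem SpectralMeasure.diag_ofMeasures (hP : ∀ ω, MeasurableSet ω → IsStarProjection (P ω))
    (hm : ∀ u ω, MeasurableSet ω → inner ℂ u (P ω u) = ((m u).real ω : ℂ))
    (huniv : ∀ u, (m u).real Set.univ = ‖u‖ ^ 2)
    (hinter : ∀ ω₁ ω₂, MeasurableSet ω₁ → MeasurableSet ω₂ → P (ω₁ ∩ ω₂) = P ω₁ * P ω₂)
    (u : H) : (ofMeasures hP hm huniv hinter).diag u = m u := by
  ext ω hω
  have h := (SpectralMeasure.measure_apply _ u u hω).symm.trans
    ((ofMeasures hP hm huniv hinter).measure_self_apply u hω)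
  rw [diag_apply _ _ hω, ← ofReal_measureReal]
  congr 1
  exact_mod_cast h.symm.trans (hm u ω hω)

end Construction

theorem ofReal_comp_mem_boundedMeasurable {X : Type*} [TopologicalSpace X] [CompactSpace X]
    [MeasurableSpace X] [OpensMeasurableSpace X] (φ : C(X, ℝ)) :
    (fun x => (φ x : ℂ)) ∈ boundedMeasurable X :=
  mem_boundedMeasurable (by fun_prop) fun x =>
    (Complex.norm_real (φ x)).trans_le (φ.norm_coe_le_norm x)

section Approximation

variable {X ι : Type*} [TopologicalSpace X] [CompactSpace X] [TopologicalSpace.MetrizableSpace X]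
  [MeasurableSpace X] [BorelSpace X]

open Classical in
theorem indicatorConstLp_mem_closure_range_toLp (m : ι → Measure X) [∀ i, IsFiniteMeasure (m i)]
    {ω : Set X} (hω : MeasurableSet ω) :
    (fun i => indicatorConstLp 2 hω (measure_ne_top (m i) ω) (1 : ℝ)) ∈
      closure (Set.range fun (φ : C(X, ℝ)) i => ContinuousMap.toLp 2 (m i) ℝ φ) := by
  have hbasis := Filter.hasBasis_pi fun i => Metric.nhds_basis_eball
    (x := indicatorConstLp 2 hω (measure_ne_top (m i) ω) (1 : ℝ))
  rw [← nhds_pi] at hbasis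
  rw [mem_closure_iff_nhds_basis hbasis]
  rintro ⟨I, ε⟩ ⟨hI, hε⟩
  let μ : Measure X := ∑ i ∈ hI.toFinset, m i
  obtain ⟨δ, hδ, hδε⟩ : ∃ δ > 0, ∀ i ∈ I, δ < ε i := by
    obtain ⟨δ, hδ, h⟩ := exists_between
      ((Finset.lt_inf_iff ENNReal.zero_lt_top).2 fun i hi => hε i (hI.mem_toFinset.1 hi))
    exact ⟨δ, hδ, fun i hi => h.trans_le (Finset.inf_le (hI.mem_toFinset.2 hi))⟩
  obtain ⟨g, hg, -⟩ := (memLp_indicator_const (2 : ENNReal) hω (1 : ℝ)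
    (Or.inr (measure_ne_top μ ω))).exists_boundedContinuous_eLpNorm_sub_le (by simp) hδ.ne'
  refine ⟨_, ⟨g.toContinuousMap, rfl⟩, fun i hi => lt_of_le_of_lt ?_ (hδε i hi)⟩
  have hle : m i ≤ μ := Finset.single_le_sum (f := m) (fun _ _ => bot_le) (hI.mem_toFinset.2 hi)
  refine le_trans (le_of_eq ?_) ((eLpNorm_mono_measure _ hle).trans hg)
  rw [edist_comm, Lp.edist_def]
  refine eLpNorm_congr_ae (EventuallyEq.sub indicatorConstLp_coeFn ?_)
  exact ContinuousMap.coeFn_toLp (𝕜 := ℝ) (m i) g.toContinuousMap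

end Approximation

section Representation

variable {H : Type*} [NormedAddCommGroup H] [InnerProductSpace ℂ H] [CompleteSpace H]
  {X : Type*} [TopologicalSpace X] (Φ : C(X, ℝ) →⋆ₐ[ℝ] (H →L[ℂ] H))

theorem inner_representation_left (φ : C(X, ℝ)) (u v : H) :
    inner ℂ (Φ φ u) v = inner ℂ u (Φ φ v) := by
  have h : star (Φ φ) = Φ φ := by rw [← map_star, star_trivial]
  rw [← ContinuousLinearMap.adjoint_inner_right, ← ContinuousLinearMap.star_eq_adjoint, h]

theorem inner_representation_mul (φ ψ : C(X, ℝ)) (u v : H) :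
    inner ℂ (Φ φ u) (Φ ψ v) = inner ℂ u (Φ (φ * ψ) v) := by
  rw [inner_representation_left, map_mul, mul_apply_eq_comp]

theorem ofReal_re_inner_representation (φ : C(X, ℝ)) (u : H) :
    ((inner ℂ u (Φ φ u)).re : ℂ) = inner ℂ u (Φ φ u) := by
  rw [← Complex.conj_eq_iff_re, inner_conj_symm, inner_representation_left]

theorem re_inner_representation_nonneg {φ : C(X, ℝ)} (hφ : 0 ≤ φ) (u : H) :
    0 ≤ (inner ℂ u (Φ φ u)).re := by
  let ψ : C(X, ℝ) := ⟨fun x => √(φ x), by fun_prop⟩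
  have hψ : φ = ψ * ψ := by
    ext x
    exact (Real.mul_self_sqrt (hφ x)).symm
  rw [hψ, ← inner_representation_mul, inner_self_eq_ofReal, Complex.ofReal_re]
  positivity

variable [CompactSpace X] [TopologicalSpace.MetrizableSpace X] [MeasurableSpace X] [BorelSpace X]

/-- The positive functional `φ ↦ ⟨u, Φ(φ)u⟩`. -/
def positiveFunctional (u : H) : CompactlySupportedContinuousMap X ℝ →ₚ[ℝ] ℝ where
  toFun g := (inner ℂ u (Φ g.toContinuousMap u)).re
  map_add' g g' := by
    change (inner ℂ u (Φ (g.toContinuousMap + g'.toContinuousMap) u)).re = _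
    rw [map_add, add_apply, inner_add_right,
      Complex.add_re]
  map_smul' c g := by
    change (inner ℂ u (Φ (c • g.toContinuousMap) u)).re = _
    rw [map_smul, smul_apply, ← Complex.coe_smul, inner_smul_right, Complex.re_ofReal_mul]
    rfl
  monotone' g g' h := by
    have hsub := re_inner_representation_nonneg Φ
      (φ := g'.toContinuousMap - g.toContinuousMap) (fun x => sub_nonneg.2 (h x)) u
    rwa [map_sub, sub_apply, inner_sub_right, Complex.sub_re, sub_nonneg] at hsub

/-- The measure representing the functional `φ ↦ ⟨u, Φ(φ)u⟩`. -/
def scalarMeasure (u : H) : Measure X := RealRMK.rieszMeasure (positiveFunctional Φ u)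

instance (u : H) : IsFiniteMeasure (scalarMeasure Φ u) :=
  inferInstanceAs (IsFiniteMeasure (RealRMK.rieszMeasure _))

theorem inner_representation (u : H) (φ : C(X, ℝ)) :
    inner ℂ u (Φ φ u) = ((∫ x, φ x ∂(scalarMeasure Φ u) : ℝ) : ℂ) := by
  rw [← ofReal_re_inner_representation]
  exact congrArg _ (RealRMK.integral_rieszMeasure (positiveFunctional Φ u)
    ⟨φ, HasCompactSupport.of_compactSpace _⟩).symm

theorem scalarMeasure_real_univ (u : H) : (scalarMeasure Φ u).real Set.univ = ‖u‖ ^ 2 := by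
  have h := inner_representation Φ u 1
  rw [map_one, one_apply_eq_self, inner_self_eq_ofReal, Complex.ofReal_inj] at h
  simpa using h.symm

theorem inner_representation_eq_inner_toLp (u : H) (φ ψ : C(X, ℝ)) :
    inner ℂ (Φ φ u) (Φ ψ u) = ((inner ℝ (ContinuousMap.toLp 2 (scalarMeasure Φ u) ℝ φ)
      (ContinuousMap.toLp 2 (scalarMeasure Φ u) ℝ ψ) : ℝ) : ℂ) := by
  rw [inner_representation_mul, inner_representation, ContinuousMap.inner_toLp]
  refine congrArg _ (integral_congr_ae (Eventually.of_forall fun x => ?_))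
  simp [mul_comm]

theorem norm_representation_eq_norm_toLp (u : H) (φ : C(X, ℝ)) :
    ‖Φ φ u‖ = ‖ContinuousMap.toLp 2 (scalarMeasure Φ u) ℝ φ‖ := by
  have h := inner_representation_eq_inner_toLp Φ u φ φ
  rw [inner_self_eq_ofReal, real_inner_self_eq_norm_sq, Complex.ofReal_inj] at h
  exact (sq_eq_sq₀ (norm_nonneg _) (norm_nonneg _)).1 h

variable {ω ω' : Set X} (hω : MeasurableSet ω) (hω' : MeasurableSet ω')

/-- The filter of approximations of the indicator function of `ω` by continuous functions, in all
the spaces `L²(m_u)` simultaneously; here `m_u` is the measure representing `φ ↦ ⟨u, Φ(φ)u⟩`. -/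
def indicatorFilter : Filter C(X, ℝ) :=
  comap (fun φ u => ContinuousMap.toLp 2 (scalarMeasure Φ u) ℝ φ)
    (𝓝 fun u => indicatorConstLp 2 hω (measure_ne_top (scalarMeasure Φ u) ω) (1 : ℝ))

instance : (indicatorFilter Φ hω).NeBot :=
  comap_neBot_iff_frequently.2 (mem_closure_iff_frequently.1
    (indicatorConstLp_mem_closure_range_toLp _ hω))

theorem tendsto_toLp_indicatorFilter (u : H) :
    Tendsto (ContinuousMap.toLp 2 (scalarMeasure Φ u) ℝ) (indicatorFilter Φ hω)
      (𝓝 (indicatorConstLp 2 hω (measure_ne_top (scalarMeasure Φ u) ω) 1)) :=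
  tendsto_pi_nhds.1 (tendsto_comap (f := fun (φ : C(X, ℝ)) u =>
    ContinuousMap.toLp 2 (scalarMeasure Φ u) ℝ φ)) u

theorem exists_tendsto_representation_apply (u : H) :
    ∃ w, Tendsto (fun φ => Φ φ u) (indicatorFilter Φ hω) (𝓝 w) := by
  refine cauchy_map_iff_exists_tendsto.1 ?_
  have hcauchy := (tendsto_toLp_indicatorFilter Φ hω u).cauchy_map
  rw [cauchy_map_iff, tendsto_uniformity_iff_dist_tendsto_zero] at hcauchy ⊢
  refine ⟨inferInstance, hcauchy.2.congr fun p => ?_⟩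
  rw [dist_eq_norm, dist_eq_norm, ← map_sub, ← norm_representation_eq_norm_toLp, map_sub, sub_apply]

theorem tendsto_inner_representation (u : H) :
    Tendsto (fun p : C(X, ℝ) × C(X, ℝ) => inner ℂ (Φ p.1 u) (Φ p.2 u))
      (indicatorFilter Φ hω ×ˢ indicatorFilter Φ hω')
      (𝓝 ((scalarMeasure Φ u).real (ω ∩ ω') : ℂ)) := by
  simp_rw [inner_representation_eq_inner_toLp]
  refine (Complex.continuous_ofReal.tendsto _).comp ?_
  have h := ((tendsto_toLp_indicatorFilter Φ hω u).comp tendsto_fst).inner (𝕜 := ℝ)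
    ((tendsto_toLp_indicatorFilter Φ hω' u).comp tendsto_snd)
  rwa [L2.real_inner_indicatorConstLp_one_indicatorConstLp_one] at h

theorem exists_tendsto_representation :
    ∃ P : H →L[ℂ] H, ∀ u, Tendsto (fun φ => Φ φ u) (indicatorFilter Φ hω) (𝓝 (P u)) := by
  choose P hP using exists_tendsto_representation_apply Φ hω
  let P' : H →ₗ[ℂ] H :=
    { toFun := P
      map_add' u v := tendsto_nhds_unique (hP (u + v)) (by
        simp_rw [map_add]
        exact (hP u).add (hP v))
      map_smul' c u := tendsto_nhds_unique (hP (c • u)) (by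
        simp_rw [map_smul]
        exact (hP u).const_smul c) }
  refine ⟨P'.mkContinuous 1 fun u => ?_, hP⟩
  have hsq : inner ℂ (P u) (P u) = ((scalarMeasure Φ u).real (ω ∩ ω) : ℂ) :=
    tendsto_nhds_unique (((hP u).comp tendsto_fst).inner ((hP u).comp tendsto_snd))
      (tendsto_inner_representation Φ hω hω u)
  rw [inner_self_eq_ofReal, Complex.ofReal_inj] at hsq
  rw [one_mul]
  refine le_of_sq_le_sq ?_ (norm_nonneg u)
  change ‖P u‖ ^ 2 ≤ ‖u‖ ^ 2
  rw [hsq, ← scalarMeasure_real_univ Φ u]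
  exact measureReal_mono (Set.subset_univ _)

open Classical in
/-- The spectral projection of a representation `Φ` of `C(X)`: the strong limit of `Φ(φ)` as `φ`
tends to the indicator function of `ω`. The value on non-measurable sets is irrelevant. -/
def spectralProj (ω : Set X) : H →L[ℂ] H :=
  if hω : MeasurableSet ω then (exists_tendsto_representation Φ hω).choose else 0

theorem tendsto_spectralProj (u : H) :
    Tendsto (fun φ => Φ φ u) (indicatorFilter Φ hω) (𝓝 (spectralProj Φ ω u)) := by
  rw [spectralProj, dif_pos hω]
  exact (exists_tendsto_representation Φ hω).choose_spec u

include hω in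
theorem inner_spectralProj_left (u v : H) :
    inner ℂ (spectralProj Φ ω u) v = inner ℂ u (spectralProj Φ ω v) := by
  refine tendsto_nhds_unique ((tendsto_spectralProj Φ hω u).inner tendsto_const_nhds) ?_
  simp_rw [inner_representation_left]
  exact tendsto_const_nhds.inner (tendsto_spectralProj Φ hω v)

include hω hω' in
theorem inner_spectralProj_spectralProj (u : H) :
    inner ℂ (spectralProj Φ ω u) (spectralProj Φ ω' u) = (scalarMeasure Φ u).real (ω ∩ ω') :=
  tendsto_nhds_unique (((tendsto_spectralProj Φ hω u).comp tendsto_fst).inner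
    ((tendsto_spectralProj Φ hω' u).comp tendsto_snd)) (tendsto_inner_representation Φ hω hω' u)

theorem inner_spectralProj (u : H) (ω : Set X) (hω : MeasurableSet ω) :
    inner ℂ u (spectralProj Φ ω u) = (scalarMeasure Φ u).real ω := by
  let m := scalarMeasure Φ u
  have hlim := (tendsto_toLp_indicatorFilter Φ hω u).inner (𝕜 := ℝ)
    (tendsto_const_nhds (x := ContinuousMap.toLp 2 m ℝ (1 : C(X, ℝ))))
  have hint : ∫ x in ω, ContinuousMap.toLp 2 m ℝ (1 : C(X, ℝ)) x ∂m = m.real ω := by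
    rw [setIntegral_congr_ae hω ((ContinuousMap.coeFn_toLp m (1 : C(X, ℝ))).mono fun x hx _ => hx)]
    simp
  rw [L2.inner_indicatorConstLp_one hω, hint] at hlim
  refine tendsto_nhds_unique (tendsto_const_nhds.inner (tendsto_spectralProj Φ hω u)) ?_
  refine ((Complex.continuous_ofReal.tendsto _).comp hlim).congr fun φ => ?_
  rw [Function.comp_apply, ← inner_representation_eq_inner_toLp, map_one, one_apply_eq_self,
    inner_representation_left]

theorem spectralProj_inter (ω₁ ω₂ : Set X) (h₁ : MeasurableSet ω₁) (h₂ : MeasurableSet ω₂) :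
    spectralProj Φ (ω₁ ∩ ω₂) = spectralProj Φ ω₁ * spectralProj Φ ω₂ :=
  ext_inner_self fun u => by
    rw [inner_spectralProj Φ u _ (h₁.inter h₂), mul_apply_eq_comp,
      ← inner_spectralProj_left Φ h₁, inner_spectralProj_spectralProj Φ h₁ h₂]

theorem isStarProjection_spectralProj (ω : Set X) (hω : MeasurableSet ω) :
    IsStarProjection (spectralProj Φ ω) where
  isIdempotentElem := by
    rw [IsIdempotentElem, ← spectralProj_inter Φ ω ω hω hω, Set.inter_self]
  isSelfAdjoint := ContinuousLinearMap.isSelfAdjoint_iff_isSymmetric.2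
    (inner_spectralProj_left Φ hω)

/-- The spectral measure of a representation of `C(X)`, for a compact metrizable space `X`. -/
def representationMeasure : SpectralMeasure X H :=
  .ofMeasures (isStarProjection_spectralProj Φ) (inner_spectralProj Φ) (scalarMeasure_real_univ Φ)
    (spectralProj_inter Φ)

theorem calculus_representationMeasure (φ : C(X, ℝ)) :
    (representationMeasure Φ).calculus ⟨_, ofReal_comp_mem_boundedMeasurable φ⟩ = Φ φ :=
  ext_inner_self fun u => by
    rw [SpectralMeasure.inner_calculus_self, representationMeasure,
      SpectralMeasure.diag_ofMeasures, inner_representation, integral_complex_ofReal]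

end Representation

/-! ### Resolvents -/

section Resolvent

variable {E : Type*} [SeminormedAddCommGroup E] [NormedSpace ℂ E] {T : E →ₗ.[ℂ] E} {ξ : ℂ}

theorem mem_resolventSet_of_graph (R : E →L[ℂ] E) (hR : ∀ y, (R y, ξ • R y - y) ∈ T.graph)
    (hker : ∀ x, (x, ξ • x) ∈ T.graph → x = 0) : ξ ∈ resolventSet T := by
  refine ⟨R, fun y => ?_, fun x => ?_⟩
  · obtain ⟨x, hx, hTx⟩ := T.mem_graph_iff.1 (hR y)
    simp only at hx hTx
    have hmem : R y ∈ T.domain := hx ▸ x.2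
    obtain rfl : x = ⟨R y, hmem⟩ := Subtype.ext hx
    exact ⟨hmem, by rw [hTx, sub_sub_cancel]⟩
  · have hsub := T.graph.sub_mem (T.mem_graph x) (hR (ξ • (x : E) - T x))
    refine (sub_eq_zero.1 (hker _ ?_)).symm
    convert hsub using 1
    exact Prod.ext rfl (by simp only [Prod.snd_sub, smul_sub]; abel)

theorem exists_bound_of_mem_resolventSet (hξ : ξ ∈ resolventSet T) :
    ∃ C > 0, ∀ x : T.domain, ‖(x : E)‖ ≤ C * ‖ξ • (x : E) - T x‖ := by
  obtain ⟨R, -, hR⟩ := hξ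
  refine ⟨‖R‖ + 1, by positivity, fun x => ?_⟩
  nth_rw 1 [← hR x]
  exact (R.le_opNorm _).trans (by gcongr; exact le_add_of_nonneg_right zero_le_one)

end Resolvent

/-! ### Selfadjoint operators -/

section SelfAdjoint

variable {H : Type*} [NormedAddCommGroup H] [InnerProductSpace ℂ H] {A : H →ₗ.[ℂ] H}

variable (A) in
/-- The map `(x, Ax) ↦ Ax - sx` on the graph of `A`. -/
def graphSub (s : ℝ) : A.graph →L[ℂ] H :=
  (ContinuousLinearMap.snd ℂ H H - (s : ℂ) • ContinuousLinearMap.fst ℂ H H).comp A.graph.subtypeL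

theorem ker_graphSub_eq_bot {s δ : ℝ} (hδ : 0 < δ)
    (h : ∀ p : A.graph, δ * ‖p.1.1‖ ≤ ‖graphSub A s p‖) : (graphSub A s).ker = ⊥ := by
  refine LinearMap.ker_eq_bot'.2 fun p (hp : graphSub A s p = 0) => ?_
  have hle := h p
  rw [hp, norm_zero] at hle
  have hfst : p.1.1 = 0 := norm_le_zero_iff.1 (nonpos_of_mul_nonpos_right hle hδ)
  have hsnd : p.1.2 = (s : ℂ) • p.1.1 := sub_eq_zero.1 hp
  exact Subtype.ext (Prod.ext hfst (by rw [hsnd, hfst, smul_zero]; rfl))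

theorem eq_zero_of_smul_mem_graph {s : ℝ} (hker : (graphSub A s).ker = ⊥) {x : H}
    (hx : (x, (s : ℂ) • x) ∈ A.graph) : x = 0 :=
  congrArg (fun p : A.graph => p.1.1) (LinearMap.ker_eq_bot'.1 hker ⟨_, hx⟩ (sub_self _))

variable [CompleteSpace H]

theorem inner_left_of_mem_graph (hA : IsSelfAdjoint A) {x y x' y' : H} (h : (x, y) ∈ A.graph)
    (h' : (x', y') ∈ A.graph) : inner ℂ y x' = inner ℂ x y' := by
  obtain ⟨x, rfl, rfl⟩ := A.mem_graph_iff.1 h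
  obtain ⟨x', rfl, rfl⟩ := A.mem_graph_iff.1 h'
  have hadj := LinearPMap.adjoint_isFormalAdjoint hA.dense_domain
  rw [LinearPMap.isSelfAdjoint_def.1 hA] at hadj
  exact hadj x x'

theorem mem_graph_of_forall_inner (hA : IsSelfAdjoint A) {y h : H}
    (hy : ∀ x : A.domain, inner ℂ h (x : H) = inner ℂ y (A x)) : (y, h) ∈ A.graph := by
  have hmem := A.mem_adjoint_domain_of_exists y ⟨h, hy⟩
  have hgraph := A.adjoint.mem_graph ⟨y, hmem⟩
  rw [LinearPMap.adjoint_apply_eq hA.dense_domain ⟨y, hmem⟩ hy] at hgraph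
  change (y, h) ∈ A.adjoint.graph at hgraph
  rwa [LinearPMap.isSelfAdjoint_def.1 hA] at hgraph

theorem isClosed_range_graphSub (hA : A.IsClosed) {s δ : ℝ} (hδ : 0 < δ)
    (h : ∀ p : A.graph, δ * ‖p.1.1‖ ≤ ‖graphSub A s p‖) : IsClosed (Set.range (graphSub A s)) := by
  have : CompleteSpace A.graph := hA.completeSpace_coe
  have hanti : AntilipschitzWith (Real.toNNReal (1 + (1 + |s|) * δ⁻¹)) (graphSub A s) := by
    refine AddMonoidHomClass.antilipschitz_of_bound _ fun p => ?_
    have hfst : ‖p.1.1‖ ≤ δ⁻¹ * ‖graphSub A s p‖ := by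
      rw [inv_mul_eq_div, le_div_iff₀' hδ]
      exact h p
    have hsnd : ‖p.1.2‖ ≤ (1 + |s| * δ⁻¹) * ‖graphSub A s p‖ := by
      calc ‖p.1.2‖ = ‖graphSub A s p + (s : ℂ) • p.1.1‖ := by simp [graphSub]
        _ ≤ ‖graphSub A s p‖ + |s| * ‖p.1.1‖ := by
          refine (norm_add_le _ _).trans_eq ?_
          rw [norm_smul, Complex.norm_real, Real.norm_eq_abs]
        _ ≤ ‖graphSub A s p‖ + |s| * (δ⁻¹ * ‖graphSub A s p‖) := by gcongr
        _ = _ := by ring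
    rw [Real.coe_toNNReal _ (by positivity)]
    refine max_le (hfst.trans ?_) (hsnd.trans ?_) <;> gcongr ?_ * _
    · nlinarith [abs_nonneg s, mul_nonneg (abs_nonneg s) (inv_nonneg.2 hδ.le)]
    · nlinarith [inv_pos.2 hδ]
  exact hanti.isClosed_range (graphSub A s).uniformContinuous

theorem range_graphSub_eq_top (hA : IsSelfAdjoint A) {s : ℝ} (hker : (graphSub A s).ker = ⊥)
    (hclosed : IsClosed (Set.range (graphSub A s))) : (graphSub A s).range = ⊤ := by
  have : CompleteSpace (graphSub A s).range := hclosed.completeSpace_coe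
  refine Submodule.orthogonal_eq_bot_iff.1 ((Submodule.eq_bot_iff _).2 fun y hy => ?_)
  refine eq_zero_of_smul_mem_graph hker (mem_graph_of_forall_inner hA fun x => ?_)
  have horth : inner ℂ y (A x - (s : ℂ) • (x : H)) = 0 :=
    Submodule.inner_left_of_mem_orthogonal
      (LinearMap.mem_range_self (graphSub A s).toLinearMap ⟨_, A.mem_graph x⟩) hy
  rw [inner_sub_right, sub_eq_zero] at horth
  rw [horth, inner_smul_left, inner_smul_right, Complex.conj_ofReal]

theorem mem_resolventSet_of_forall_le (hA : IsSelfAdjoint A) {s δ : ℝ} (hδ : 0 < δ)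
    (h : ∀ x : A.domain, δ * ‖(x : H)‖ ≤ ‖A x - (s : ℂ) • (x : H)‖) :
    (s : ℂ) ∈ resolventSet A := by
  have hgraph (p : A.graph) : δ * ‖p.1.1‖ ≤ ‖graphSub A s p‖ := by
    obtain ⟨⟨x, y⟩, hxy⟩ := p
    obtain ⟨x, rfl, rfl⟩ := A.mem_graph_iff.1 hxy
    exact h x
  have hker := ker_graphSub_eq_bot hδ hgraph
  have hrange := range_graphSub_eq_top hA hker (isClosed_range_graphSub hA.isClosed hδ hgraph)
  have : CompleteSpace A.graph := hA.isClosed.completeSpace_coe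
  let q := ContinuousLinearEquiv.ofBijective (graphSub A s) hker hrange
  refine mem_resolventSet_of_graph
    (-(ContinuousLinearMap.fst ℂ H H ∘L A.graph.subtypeL ∘L q.symm.toContinuousLinearMap))
    (fun y => ?_) fun x => eq_zero_of_smul_mem_graph hker
  obtain ⟨p, rfl⟩ := q.surjective y
  convert A.graph.neg_mem p.2 using 1
  have hfst : (q.symm (q p)).1.1 = p.1.1 := by rw [q.symm_apply_apply]
  have hq : q p = p.1.2 - (s : ℂ) • p.1.1 := rfl
  refine Prod.ext (congrArg Neg.neg hfst) ?_
  change (s : ℂ) • -(q.symm (q p)).1.1 - q p = -p.1.2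
  rw [hfst, hq, smul_neg]
  abel

end SelfAdjoint

/-! ### The spectral measure of a strictly positive operator -/

section Inverse

variable {H : Type*} [NormedAddCommGroup H] [InnerProductSpace ℂ H] {A : H →ₗ.[ℂ] H}
  {B : H →L[ℂ] H}

variable (A B) in
/-- `B` is the inverse of `A`, as a bounded operator defined on the whole space. -/
def IsBoundedInverse : Prop := ∀ x y, (x, y) ∈ A.graph ↔ x = B y

theorem exists_isBoundedInverse (h : 0 ∈ resolventSet A) : ∃ B, IsBoundedInverse A B := by
  obtain ⟨R, hAR, hRA⟩ := h
  refine ⟨-R, fun x y => ⟨fun hxy => ?_, ?_⟩⟩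
  · obtain ⟨x, rfl, rfl⟩ := A.mem_graph_iff.1 hxy
    simpa using (hRA x).symm
  · rintro rfl
    obtain ⟨hmem, hAy⟩ := hAR y
    rw [zero_smul, zero_sub] at hAy
    have hneg := A.graph.neg_mem (A.mem_graph ⟨R y, hmem⟩)
    convert hneg using 1
    exact Prod.ext rfl hAy.symm

namespace IsBoundedInverse

variable (hAB : IsBoundedInverse A B)

include hAB

theorem mem_graph (y : H) : (B y, y) ∈ A.graph := (hAB _ _).2 rfl

theorem injective : Function.Injective B :=
  (injective_iff_map_eq_zero B).2 fun y hy => A.graph_fst_eq_zero_snd (hAB.mem_graph y) hy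

theorem isSelfAdjoint [CompleteSpace H] (hA : IsSelfAdjoint A) : IsSelfAdjoint B :=
  ContinuousLinearMap.isSelfAdjoint_iff_isSymmetric.2 fun x y =>
    (inner_left_of_mem_graph hA (hAB.mem_graph x) (hAB.mem_graph y)).symm

theorem inv_mem_realSpectrum {t : ℝ} (ht : t ∈ _root_.spectrum ℝ B) (ht₀ : t ≠ 0) :
    t⁻¹ ∈ realSpectrum A := by
  rintro ⟨R, hAR, hRA⟩
  have ht' : (t : ℂ) ≠ 0 := Complex.ofReal_ne_zero.2 ht₀
  have hBR (y : H) : B (R y) = (t : ℂ) • (R y + B y) := by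
    obtain ⟨hmem, hy⟩ := hAR y
    have h : R y = B ((t : ℂ)⁻¹ • R y - y) := by
      rw [← hAB, ← Complex.ofReal_inv]
      convert A.mem_graph ⟨R y, hmem⟩ using 2
      nth_rw 2 [← hy]
      rw [sub_sub_cancel]
    rw [map_sub, map_smul, eq_sub_iff_add_eq, eq_inv_smul_iff₀ ht'] at h
    exact h.symm
  have hRB (y : H) : R (B y) = (t : ℂ) • (R y + B y) := by
    obtain ⟨x, hx, hAx⟩ := A.mem_graph_iff.1 (hAB.mem_graph y)
    simp only at hx hAx
    have h := hRA x
    rw [hx, hAx, map_sub, map_smul, sub_eq_iff_eq_add, Complex.ofReal_inv, inv_smul_eq_iff₀ ht',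
      add_comm] at h
    exact h
  refine ht ⟨⟨algebraMap ℝ _ t - B, algebraMap ℂ _ (t : ℂ)⁻¹ - (t : ℂ)⁻¹ ^ 2 • R, ?_, ?_⟩, rfl⟩ <;>
  · ext y
    simp only [Algebra.algebraMap_eq_smul_one, mul_apply_eq_comp, sub_apply, smul_apply,
      one_apply_eq_self, map_sub, map_smul, hBR, hRB, ← Complex.coe_smul]
    match_scalars <;> field_simp <;> ring

theorem exists_measurable_inv (hne : _root_.spectrum ℝ B → Nonempty (realSpectrum A)) :
    ∃ τ : _root_.spectrum ℝ B → realSpectrum A, Measurable τ ∧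
      ∀ t : _root_.spectrum ℝ B, (t : ℝ) ≠ 0 → (τ t : ℝ) = (t : ℝ)⁻¹ := by
  have hmeas : MeasurableSet {t : _root_.spectrum ℝ B | (t : ℝ) ≠ 0} :=
    measurable_subtype_coe (measurableSet_singleton 0).compl
  let g (t : {t : _root_.spectrum ℝ B | (t : ℝ) ≠ 0}) : realSpectrum A :=
    ⟨_, hAB.inv_mem_realSpectrum t.1.2 t.2⟩
  have hg : Measurable g := by fun_prop
  obtain ⟨τ, hτ, hτg⟩ := (MeasurableEmbedding.subtype_coe hmeas).exists_measurable_extend hg hne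
  exact ⟨τ, hτ, fun t ht => congrArg Subtype.val (congrFun hτg ⟨t, ht⟩)⟩

end IsBoundedInverse

end Inverse

section StrictlyPositive

variable {H : Type*} [NormedAddCommGroup H] [InnerProductSpace ℂ H] [CompleteSpace H]
  {A : H →ₗ.[ℂ] H} {B : H →L[ℂ] H}

theorem le_of_mem_realSpectrum (hA : IsSelfAdjoint A) {c : ℝ}
    (hpos : ∀ u : A.domain, c * ‖(u : H)‖ ^ 2 ≤ (inner ℂ (u : H) (A u)).re) {s : ℝ}
    (hs : s ∈ realSpectrum A) : c ≤ s := by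
  by_contra! hlt
  refine hs (mem_resolventSet_of_forall_le hA (sub_pos.2 hlt) fun u => ?_)
  have hle : (c - s) * ‖(u : H)‖ ^ 2 ≤ ‖(u : H)‖ * ‖A u - (s : ℂ) • (u : H)‖ := by
    calc (c - s) * ‖(u : H)‖ ^ 2
        ≤ (inner ℂ (u : H) (A u - (s : ℂ) • (u : H))).re := by
          rw [inner_sub_right, inner_smul_right, inner_self_eq_ofReal, ← Complex.ofReal_mul,
            Complex.sub_re, Complex.ofReal_re, sub_mul]
          exact sub_le_sub_right (hpos u) _
      _ ≤ _ := (Complex.re_le_norm _).trans (norm_inner_le_norm _ _)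
  rcases (norm_nonneg (u : H)).eq_or_lt with hu | hu
  · simp [← hu]
  · nlinarith

theorem exists_calculus_eq_of_isSelfAdjoint (hB : IsSelfAdjoint B) :
    ∃ (F : SpectralMeasure (_root_.spectrum ℝ B) H)
      (h : (fun t : _root_.spectrum ℝ B => ((t : ℝ) : ℂ)) ∈ boundedMeasurable _),
      F.calculus ⟨_, h⟩ = B := by
  have h := calculus_representationMeasure (cfcHom (R := ℝ) (a := B) hB)
    (.restrict (_root_.spectrum ℝ B) (.id ℝ))
  rw [cfcHom_id hB] at h
  exact ⟨_, _, h⟩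

theorem IsBoundedInverse.isSpectralMeasureOf (hAB : IsBoundedInverse A B)
    (hne : ∀ s : realSpectrum A, (s : ℝ) ≠ 0) {E : SpectralMeasure (realSpectrum A) H}
    {hinv : (fun s : realSpectrum A => ((s : ℝ) : ℂ)⁻¹) ∈ boundedMeasurable (realSpectrum A)}
    (hE : E.calculus ⟨_, hinv⟩ = B) : IsSpectralMeasureOf A E := by
  refine SpectralMeasure.isIntegral_of_forall_mem_graph_iff (by fun_prop) fun u w => ?_
  have hne_inv (s : realSpectrum A) : ((s : ℝ) : ℂ)⁻¹ ≠ 0 :=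
    inv_ne_zero (Complex.ofReal_ne_zero.2 (hne s))
  rw [hAB, ← hE, ← E.hasIntegral_inv_iff hne_inv]
  simp only [Pi.inv_def, inv_inv]

theorem SpectralMeasure.proj_eq_zero_of_injective {Ω : Type*} [MeasurableSpace Ω]
    {E : SpectralMeasure Ω H} {φ : boundedMeasurable Ω} {ω : Set Ω} (hω : MeasurableSet ω)
    (hφ : ∀ s ∈ ω, φ.1 s = 0) (hinj : Function.Injective (E.calculus φ)) : E.proj ω = 0 := by
  have hmul : φ * ⟨_, indicator_one_mem_boundedMeasurable hω⟩ = 0 := by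
    ext s
    by_cases hs : s ∈ ω <;> simp [hs, hφ]
  ext u
  refine hinj ?_
  rw [← E.calculus_indicator_one hω, ← E.calculus_mul_apply, hmul]
  simp

/-- The spectral measure of `A` is the image under `t ↦ t⁻¹` of that of the bounded operator `A⁻¹`,
which does not charge `0` because `A⁻¹` is injective. -/
theorem exists_isSpectralMeasureOf (hA : IsSelfAdjoint A) (hpos : IsStrictlyPositive A) :
    ∃ E : SpectralMeasure (realSpectrum A) H, IsSpectralMeasureOf A E := by
  obtain ⟨c, hc, hpos⟩ := hpos
  have hle (s : realSpectrum A) : c ≤ s := le_of_mem_realSpectrum hA hpos s.2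
  have hzero : (0 : ℂ) ∈ resolventSet A := by
    by_contra h
    exact hc.not_ge (le_of_mem_realSpectrum hA hpos (s := 0) (by simpa [realSpectrum, spectrum]))
  obtain ⟨B, hAB⟩ := exists_isBoundedInverse hzero
  obtain ⟨F, hid, hF⟩ := exists_calculus_eq_of_isSelfAdjoint (hAB.isSelfAdjoint hA)
  have hmeas : MeasurableSet {t : _root_.spectrum ℝ B | (t : ℝ) = 0} :=
    measurable_subtype_coe (measurableSet_singleton 0)
  have hnull : F.proj {t | (t : ℝ) = 0} = 0 :=
    F.proj_eq_zero_of_injective hmeas (φ := ⟨_, hid⟩) (fun t ht => by simpa using ht)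
      (by rw [hF]; exact hAB.injective)
  have hne (t : _root_.spectrum ℝ B) : Nonempty (realSpectrum A) := by
    by_contra hempty
    have hall : {t : _root_.spectrum ℝ B | (t : ℝ) = 0} = Set.univ :=
      Set.eq_univ_of_forall fun t => by_contra fun ht => hempty ⟨_, hAB.inv_mem_realSpectrum t.2 ht⟩
    have : Subsingleton (H →L[ℂ] H) :=
      subsingleton_of_zero_eq_one (by rw [← hnull, hall, F.proj_univ])
    exact t.2 (isUnit_of_subsingleton _)
  obtain ⟨τ, hτ, hτ_inv⟩ := hAB.exists_measurable_inv hne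
  have hinv : (fun s : realSpectrum A => ((s : ℝ) : ℂ)⁻¹) ∈ boundedMeasurable (realSpectrum A) :=
    mem_boundedMeasurable (C := c⁻¹) (by fun_prop) fun s => by
      rw [norm_inv, Complex.norm_real, Real.norm_of_nonneg (hc.le.trans (hle s))]
      exact inv_anti₀ hc (hle s)
  have hcalc : (F.map hτ).calculus ⟨_, hinv⟩ = B := by
    refine (F.calculus_map hτ _).trans (.trans ?_ hF)
    refine F.calculus_congr hmeas hnull fun t ht => ?_
    simp [hτ_inv t ht]
  exact ⟨F.map hτ, hAB.isSpectralMeasureOf (fun s => (hc.trans_le (hle s)).ne') hcalc⟩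

end StrictlyPositive

/-! ### The spectrum of a selfadjoint operator -/

section Weyl

variable {H : Type*} [NormedAddCommGroup H] [InnerProductSpace ℂ H] [CompleteSpace H]
  {A : H →ₗ.[ℂ] H}

theorem isClosed_realSpectrum (hA : IsSelfAdjoint A) : IsClosed (realSpectrum A) := by
  rw [← isOpen_compl_iff, Metric.isOpen_iff]
  intro s hs
  obtain ⟨C, hC, hbound⟩ := exists_bound_of_mem_resolventSet (not_not.1 hs)
  refine ⟨(2 * C)⁻¹, by positivity, fun t ht => not_not.2 ?_⟩
  refine mem_resolventSet_of_forall_le hA (δ := (2 * C)⁻¹) (by positivity) fun x => ?_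
  have hdiff : ‖((t - s : ℝ) : ℂ) • (x : H)‖ ≤ (2 * C)⁻¹ * ‖(x : H)‖ := by
    rw [norm_smul, Complex.norm_real]
    exact mul_le_mul_of_nonneg_right (Metric.mem_ball.1 ht).le (norm_nonneg _)
  have htri : ‖(s : ℂ) • (x : H) - A x‖ ≤
      ‖A x - (t : ℂ) • (x : H)‖ + ‖((t - s : ℝ) : ℂ) • (x : H)‖ := by
    refine (norm_sub_le_norm_sub_add_norm_sub _ ((t : ℂ) • (x : H)) _).trans_eq ?_
    rw [norm_sub_rev _ (A x), ← sub_smul, ← Complex.ofReal_sub, norm_smul, norm_smul,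
      Complex.norm_real, Complex.norm_real, norm_sub_rev s t, add_comm]
  have hC' : C * (2 * C)⁻¹ = 2⁻¹ := by field_simp
  have hle := (hbound x).trans
    (mul_le_mul_of_nonneg_left (htri.trans (add_le_add_right hdiff _)) hC.le)
  rw [mul_add, ← mul_assoc, hC'] at hle
  refine le_of_mul_le_mul_left ?_ hC
  rw [← mul_assoc, hC']
  linarith

theorem IsSpectralMeasureOf.proj_ne_zero (hA : IsSelfAdjoint A)
    {E : SpectralMeasure (realSpectrum A) H} (hE : IsSpectralMeasureOf A E)
    {U : Set (realSpectrum A)} (hU : IsOpen U) (hne : U.Nonempty) : E.proj U ≠ 0 := by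
  intro hnull
  obtain ⟨s₀, hs₀⟩ := hne
  obtain ⟨ε, hε, hball⟩ := Metric.isOpen_iff.1 hU s₀ hs₀
  refine s₀.2 (mem_resolventSet_of_forall_le hA hε fun x => ?_)
  have hsub : E.HasIntegral (fun s => ((s - s₀ : ℝ) : ℂ)) x (A x - ((s₀ : ℝ) : ℂ) • (x : H)) := by
    have h := (hE.mem_graph_iff.1 (A.mem_graph x)).add (by fun_prop) (by fun_prop)
      ((E.hasIntegral_one (x : H)).const_mul measurable_one (-((s₀ : ℝ) : ℂ)))
    convert h using 1
    · ext s
      simp [sub_eq_add_neg]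
    · rw [neg_smul, sub_eq_add_neg]
  refine hsub.le_norm (by fun_prop) hU.measurableSet hnull hε.le fun s hs => ?_
  rw [Complex.norm_real, ← dist_eq_norm]
  exact not_lt.1 fun hlt => hs (hball hlt)

end Weyl

/-! ### The calculus of a strictly positive operator -/

section CalculusMeasure

variable {H : Type*} [NormedAddCommGroup H] [InnerProductSpace ℂ H] [CompleteSpace H]
  {A : H →ₗ.[ℂ] H}

/-- `E` is the spectral measure of `A` by which `functionalCalculus A` is defined, and `c` is a
positive lower bound of `σ(A)`. -/
structure IsCalculusMeasure (A : H →ₗ.[ℂ] H) (E : SpectralMeasure (realSpectrum A) H) (c : ℝ) :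
    Prop where
  isSpectralMeasureOf : IsSpectralMeasureOf A E
  functionalCalculus_eq (φ : realSpectrum A → ℂ) : functionalCalculus A φ = E.integral φ
  pos : 0 < c
  le (s : realSpectrum A) : c ≤ s

theorem exists_isCalculusMeasure (hA : IsSelfAdjoint A) (hpos : IsStrictlyPositive A) :
    ∃ E c, IsCalculusMeasure A E c := by
  have h := exists_isSpectralMeasureOf hA hpos
  obtain ⟨c, hc, hpos⟩ := hpos
  exact ⟨h.choose, c, h.choose_spec, fun _ => dif_pos h, hc,
    fun s => le_of_mem_realSpectrum hA hpos s.2⟩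

theorem IsCalculusMeasure.mem_graph_realCalculus_iff {E : SpectralMeasure (realSpectrum A) H}
    {c : ℝ} (hE : IsCalculusMeasure A E c) {f : realSpectrum A → ℝ} (hf : Measurable f) {u w : H} :
    (u, w) ∈ (realCalculus A f).graph ↔ E.HasIntegral (fun s => (f s : ℂ)) u w := by
  rw [realCalculus, hE.functionalCalculus_eq]
  exact SpectralMeasure.mem_graph_integral_iff (by fun_prop)

end CalculusMeasure

/-! ### The generator in spectral coordinates -/

theorem div_mem_boundedMeasurable {Ω : Type*} [MeasurableSpace Ω] {φ ψ : Ω → ℂ}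
    (hφ : Measurable φ) (hψ : Measurable ψ) {C : ℝ} (hC : 0 ≤ C) (h : ∀ s, ‖φ s‖ ≤ C * ‖ψ s‖) :
    (fun s => φ s / ψ s) ∈ boundedMeasurable Ω :=
  mem_boundedMeasurable (hφ.div hψ) fun s => by
    rw [norm_div]
    exact div_le_of_le_mul₀ (norm_nonneg _) hC (h s)

theorem exists_real_boundedMeasurable_mul_eq {Ω : Type*} [MeasurableSpace Ω] {g f : Ω → ℝ}
    (hg : Measurable g) (hg0 : ∀ s, 0 ≤ g s) (hf : Measurable f) (hf0 : ∀ s, 0 ≤ f s) :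
    ∃ κ α β : boundedMeasurable Ω, star κ = κ ∧ (∀ s, (1 + g s + f s) * κ.1 s = 1) ∧
      (∀ s, α.1 s = g s * κ.1 s) ∧ ∀ s, β.1 s = f s * κ.1 s := by
  let D (s : Ω) : ℝ := 1 + g s + f s
  have hD (s : Ω) : 0 < D s := by linarith [hg0 s, hf0 s]
  have hquot {q : Ω → ℝ} (hq : Measurable q) (hq0 : ∀ s, 0 ≤ q s) (hqD : ∀ s, q s ≤ D s) :
      (fun s => (q s : ℂ) / (D s : ℂ)) ∈ boundedMeasurable Ω :=
    div_mem_boundedMeasurable (by fun_prop) (by fun_prop) zero_le_one fun s => by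
      rw [Complex.norm_of_nonneg (hq0 s), Complex.norm_of_nonneg (hD s).le, one_mul]
      exact hqD s
  let κ : boundedMeasurable Ω := ⟨_, hquot (q := fun _ => 1) measurable_const
    (fun _ => zero_le_one) fun s => by linarith [hg0 s, hf0 s]⟩
  have hκ (s : Ω) : κ.1 s = ((D s : ℝ) : ℂ)⁻¹ := by simp [κ]
  refine ⟨κ, ⟨_, hquot hg hg0 fun s => by linarith [hf0 s]⟩,
    ⟨_, hquot hf hf0 fun s => by linarith [hg0 s]⟩, ?_, fun s => ?_, fun s => ?_, fun s => ?_⟩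
  · ext s
    change starRingEnd ℂ (κ.1 s) = κ.1 s
    rw [hκ, map_inv₀, Complex.conj_ofReal]
  · rw [hκ, ← Complex.ofReal_one, ← Complex.ofReal_add, ← Complex.ofReal_add]
    exact mul_inv_cancel₀ (Complex.ofReal_ne_zero.2 (hD s).ne')
  all_goals
    rw [hκ]
    exact div_eq_mul_inv _ _

namespace SpectralMeasure

variable {H : Type*} [NormedAddCommGroup H] [InnerProductSpace ℂ H] [CompleteSpace H]
  {Ω : Type*} [MeasurableSpace Ω] (E : SpectralMeasure Ω H) {g f : Ω → ℝ}

theorem hasIntegral_calculus_of_eq_mul {ψ : Ω → ℂ} (hψ : Measurable ψ) {κ α : boundedMeasurable Ω}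
    (h : ∀ s, α.1 s = ψ s * κ.1 s) (z : H) :
    E.HasIntegral ψ (E.calculus κ z) (E.calculus α z) := by
  rw [(E.hasIntegral_calculus κ z).hasIntegral_iff_mul κ.2.1 hψ,
    show ψ * (κ : Ω → ℂ) = α from (funext h).symm]
  exact E.hasIntegral_calculus α z

theorem hasIntegral_and_hasIntegral_iff (hg : Measurable g) (hf : Measurable f)
    {κ α β : boundedMeasurable Ω} (hκ : ∀ s, (1 + g s + f s) * κ.1 s = 1)
    (hα : ∀ s, α.1 s = g s * κ.1 s) (hβ : ∀ s, β.1 s = f s * κ.1 s) {w a b : H} :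
    E.HasIntegral (fun s => (g s : ℂ)) w a ∧ E.HasIntegral (fun s => (f s : ℂ)) w b ↔
      ∃ z, w = E.calculus κ z ∧ a = E.calculus α z ∧ b = E.calculus β z := by
  have hαz := E.hasIntegral_calculus_of_eq_mul (by fun_prop) hα
  have hβz := E.hasIntegral_calculus_of_eq_mul (by fun_prop) hβ
  constructor
  · rintro ⟨ha, hb⟩
    have hsum := ((E.hasIntegral_one w).add measurable_one (by fun_prop) ha).add
      (by fun_prop) (by fun_prop) hb
    have hinv : (κ : Ω → ℂ)⁻¹ = 1 + (fun s => (g s : ℂ)) + fun s => (f s : ℂ) :=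
      funext fun s => inv_eq_of_mul_eq_one_left (hκ s)
    rw [← hinv, E.hasIntegral_inv_iff fun s => right_ne_zero_of_mul_eq_one (hκ s)] at hsum
    generalize w + a + b = z at hsum
    subst hsum
    exact ⟨z, rfl, ha.unique (hαz z), hb.unique (hβz z)⟩
  · rintro ⟨z, rfl, rfl, rfl⟩
    exact ⟨hαz z, hβz z⟩

end SpectralMeasure

section Coordinates

variable {H : Type*} [NormedAddCommGroup H] [InnerProductSpace ℂ H] [CompleteSpace H]
  {A : H →ₗ.[ℂ] H} {E : SpectralMeasure (realSpectrum A) H} {c : ℝ} {f : realSpectrum A → ℝ}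

theorem IsCalculusMeasure.nonneg (hE : IsCalculusMeasure A E c) (s : realSpectrum A) :
    0 ≤ (s : ℝ) := hE.pos.le.trans (hE.le s)

theorem IsCalculusMeasure.isWeakSum_iff (hE : IsCalculusMeasure A E c) (hf : Measurable f)
    {u v h : H} : IsWeakSum A f u v h ↔ ∀ w a b,
      E.HasIntegral (fun s => ((s : ℝ) : ℂ)) w a ∧ E.HasIntegral (fun s => (f s : ℂ)) w b →
        inner ℂ u a + inner ℂ v b = inner ℂ h w := by
  constructor
  · rintro hsum w a b ⟨ha, hb⟩
    rw [← hE.isSpectralMeasureOf.mem_graph_iff] at ha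
    rw [← hE.mem_graph_realCalculus_iff hf] at hb
    obtain ⟨x, rfl, rfl⟩ := A.mem_graph_iff.1 ha
    obtain ⟨⟨y, hy⟩, hyx, rfl⟩ := (realCalculus A f).mem_graph_iff.1 hb
    obtain rfl : y = x := hyx
    exact hsum x x.2 hy
  · intro hsum w hA hf'
    exact hsum w _ _ ⟨hE.isSpectralMeasureOf.mem_graph_iff.1 (A.mem_graph ⟨w, hA⟩),
      (hE.mem_graph_realCalculus_iff hf).1 ((realCalculus A f).mem_graph ⟨w, hf'⟩)⟩

theorem IsCalculusMeasure.exists_isWeakSum_iff (hE : IsCalculusMeasure A E c) (hf : Measurable f)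
    (hf0 : ∀ s, 0 ≤ f s) :
    ∃ κ α β : boundedMeasurable (realSpectrum A), (∀ s, κ.1 s ≠ 0) ∧
      (∀ s, α.1 s = (s : ℝ) * κ.1 s) ∧ (∀ s, β.1 s = f s * κ.1 s) ∧
      ∀ u v h, IsWeakSum A f u v h ↔ E.calculus α u + E.calculus β v = E.calculus κ h := by
  obtain ⟨κ, α, β, hstar, hκ, hα, hβ⟩ :=
    exists_real_boundedMeasurable_mul_eq measurable_subtype_coe hE.nonneg hf hf0
  have hgraph (w a b : H) :=
    E.hasIntegral_and_hasIntegral_iff measurable_subtype_coe hf hκ hα hβ (w := w) (a := a) (b := b)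
  have hstar_mul {q : realSpectrum A → ℝ} {θ : boundedMeasurable (realSpectrum A)}
      (hθ : ∀ s, θ.1 s = q s * κ.1 s) : star θ = θ := by
    ext s
    have hs : starRingEnd ℂ (κ.1 s) = κ.1 s := congrFun (congrArg Subtype.val hstar) s
    change starRingEnd ℂ (θ.1 s) = θ.1 s
    rw [hθ, map_mul, Complex.conj_ofReal, hs]
  refine ⟨κ, α, β, fun s => right_ne_zero_of_mul_eq_one (hκ s), hα, hβ, fun u v h => ?_⟩
  rw [hE.isWeakSum_iff hf]
  have hweak (z : H) : inner ℂ (E.calculus α u + E.calculus β v) z =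
      inner ℂ u (E.calculus α z) + inner ℂ v (E.calculus β z) := by
    rw [inner_add_left, E.inner_calculus_left, E.inner_calculus_left, hstar_mul hα, hstar_mul hβ]
  constructor
  · refine fun hsum => ext_inner_right ℂ fun z => ?_
    rw [hweak, hsum _ _ _ ((hgraph _ _ _).2 ⟨z, rfl, rfl, rfl⟩), E.inner_calculus_left, hstar]
  · rintro hsum w a b hwab
    obtain ⟨z, rfl, rfl, rfl⟩ := (hgraph w a b).1 hwab
    rw [← hweak, hsum, E.inner_calculus_left, hstar]

theorem IsCalculusMeasure.exists_linearIsometryEquiv (hE : IsCalculusMeasure A E c) :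
    ∃ (ρ : boundedMeasurable (realSpectrum A)) (e : HOne A ≃ₗᵢ[ℂ] H),
      (∀ s : realSpectrum A, (s : ℝ) * ρ.1 s ^ 2 = 1) ∧
        ∀ x, HOne.incl A x = E.calculus ρ (e x) := by
  have hsqrt (s : realSpectrum A) : 0 < √(s : ℝ) := Real.sqrt_pos.2 (hE.pos.trans_le (hE.le s))
  let ρ : boundedMeasurable (realSpectrum A) := ⟨fun s => ((√(s : ℝ) : ℝ) : ℂ)⁻¹,
    mem_boundedMeasurable (C := (√c)⁻¹) (by fun_prop) fun s => by
      rw [norm_inv, Complex.norm_of_nonneg (hsqrt s).le]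
      exact inv_anti₀ (Real.sqrt_pos.2 hE.pos) (Real.sqrt_le_sqrt (hE.le s))⟩
  have hρ (s : realSpectrum A) : ρ.1 s ≠ 0 :=
    inv_ne_zero (Complex.ofReal_ne_zero.2 (hsqrt s).ne')
  have hgraph (u w : H) : (u, w) ∈ (sqrtOp A).graph ↔ u = E.calculus ρ w := by
    rw [sqrtOp, hE.mem_graph_realCalculus_iff (by fun_prop), ← E.hasIntegral_inv_iff hρ,
      show (ρ : realSpectrum A → ℂ)⁻¹ = fun s : realSpectrum A => ((√(s : ℝ) : ℝ) : ℂ) from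
        funext fun s => inv_inv _]
  let T : HOne A →ₗ[ℂ] H := (sqrtOp A).toFun
  have hT (x : HOne A) : HOne.incl A x = E.calculus ρ (T x) :=
    (hgraph _ _).1 ((sqrtOp A).mem_graph x)
  have hbij : Function.Bijective T := by
    constructor
    · intro x y hxy
      exact Subtype.ext (((hT x).trans (congrArg _ hxy)).trans (hT y).symm)
    · intro w
      obtain ⟨x, -, hx⟩ := (sqrtOp A).mem_graph_iff.1 ((hgraph (E.calculus ρ w) w).2 rfl)
      exact ⟨x, hx⟩
  refine ⟨ρ, ⟨.ofBijective T hbij, fun _ => rfl⟩, fun s => ?_, hT⟩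
  have hs : (((√(s : ℝ) : ℝ) : ℂ)) ^ 2 = (s : ℝ) := by
    rw [← Complex.ofReal_pow, Real.sq_sqrt (hE.nonneg s)]
  change ((s : ℝ) : ℂ) * (((√(s : ℝ) : ℝ) : ℂ)⁻¹) ^ 2 = 1
  rw [inv_pow, hs, mul_inv_cancel₀ (Complex.ofReal_ne_zero.2 (hE.pos.trans_le (hE.le s)).ne')]

variable (A f E) in
/-- An isometry `e : H¹ ≃ H` and bounded functions of `A` that turn membership in the graph of the
generator into two equations between bounded operators: `ρ = s^{-1/2}`, so that `u = ρ(A) (e u)` for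
`u ∈ H¹`, and `α = s κ`, `β = f κ` for some nowhere vanishing `κ`. -/
structure GeneratorCoordinates where
  e : HOne A ≃ₗᵢ[ℂ] H
  ρ : boundedMeasurable (realSpectrum A)
  κ : boundedMeasurable (realSpectrum A)
  α : boundedMeasurable (realSpectrum A)
  β : boundedMeasurable (realSpectrum A)
  ρ_sq (s : realSpectrum A) : (s : ℝ) * ρ.1 s ^ 2 = 1
  κ_ne_zero (s : realSpectrum A) : κ.1 s ≠ 0
  α_apply (s : realSpectrum A) : α.1 s = (s : ℝ) * κ.1 s
  β_apply (s : realSpectrum A) : β.1 s = f s * κ.1 s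
  mem_graph_iff (U V : PhaseSpace A) : (U, V) ∈ (generator A f).graph ↔
    E.calculus ρ (e V.fst) = U.snd ∧
      E.calculus α (E.calculus ρ (e U.fst)) + E.calculus β U.snd + E.calculus κ V.snd = 0

theorem IsCalculusMeasure.nonempty_generatorCoordinates (hE : IsCalculusMeasure A E c)
    (hf : Measurable f) (hf0 : ∀ s, 0 ≤ f s) : Nonempty (GeneratorCoordinates A E f) := by
  obtain ⟨ρ, e, hρ, hincl⟩ := hE.exists_linearIsometryEquiv
  obtain ⟨κ, α, β, hκ, hα, hβ, hweak⟩ := hE.exists_isWeakSum_iff hf hf0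
  have hρ0 (s : realSpectrum A) : ρ.1 s ≠ 0 := fun h => by simpa [h] using hρ s
  have hsum (U V : PhaseSpace A) : IsWeakSum A f (HOne.incl A U.fst) U.snd (-V.snd) ↔
      E.calculus α (E.calculus ρ (e U.fst)) + E.calculus β U.snd + E.calculus κ V.snd = 0 := by
    rw [hweak, hincl, map_neg, eq_neg_iff_add_eq_zero]
  have hgraph : (generator A f).graph = generatorGraph A f := by
    refine Submodule.toLinearPMap_graph_eq _ ?_
    rintro ⟨_, V⟩ ⟨hfst, hsnd⟩ rfl
    replace hfst := (hincl _).symm.trans hfst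
    replace hsnd := (hsum 0 V).1 hsnd
    refine WithLp.ofLp_injective 2 (Prod.ext (e.injective (E.calculus_injective hρ0 ?_))
      (E.calculus_injective hκ ?_))
    · simpa using hfst
    · simpa using hsnd
  refine ⟨⟨e, ρ, κ, α, β, hρ, hκ, hα, hβ, fun U V => ?_⟩⟩
  rw [hgraph]
  exact and_congr (by rw [← hincl]) (hsum U V)

end Coordinates

/-! ### The spectrum of the generator -/

/-- The characteristic polynomial `ξ² + a ξ + s` of a mode with damping `a` and stiffness `s`. -/
def charPoly (ξ : ℂ) (a s : ℝ) : ℂ := ξ ^ 2 + a * ξ + s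

theorem charPoly_eq (ξ : ℂ) (a s : ℝ) : charPoly ξ a s = ξ * (ξ + a) + s := by
  rw [charPoly]
  ring

section Symbols

variable {σ : Set ℝ} {f : σ → ℝ} {ξ : ℂ} {ε : ℝ}

theorem norm_le_mul_norm_charPoly (hε : 0 < ε) {a s : ℝ}
    (h : ε * ‖ξ + a‖ ≤ ‖charPoly ξ a s‖) : ‖(s : ℂ)‖ ≤ (1 + ‖ξ‖ * ε⁻¹) * ‖charPoly ξ a s‖ := by
  have hle : ‖ξ + a‖ ≤ ε⁻¹ * ‖charPoly ξ a s‖ := by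
    rwa [inv_mul_eq_div, le_div_iff₀' hε]
  calc ‖(s : ℂ)‖ = ‖charPoly ξ a s - ξ * (ξ + a)‖ := by rw [charPoly_eq, add_sub_cancel_left]
    _ ≤ ‖charPoly ξ a s‖ + ‖ξ‖ * ‖ξ + a‖ := by
      rw [← norm_mul]
      exact norm_sub_le _ _
    _ ≤ ‖charPoly ξ a s‖ + ‖ξ‖ * (ε⁻¹ * ‖charPoly ξ a s‖) := by gcongr
    _ = _ := by ring

theorem exists_resolvent_symbols (hσ : ∀ s : σ, (s : ℝ) ≠ 0) (hf : Measurable f) (hε : 0 < ε)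
    (h : ∀ s, ε * ‖ξ + f s‖ ≤ ‖charPoly ξ (f s) s‖) :
    ∃ μ τ : boundedMeasurable σ, ∀ s, charPoly ξ (f s) s ≠ 0 ∧
      μ.1 s * charPoly ξ (f s) s = ξ + f s ∧ τ.1 s * charPoly ξ (f s) s = (s : ℝ) := by
  have hs (s : σ) := norm_le_mul_norm_charPoly hε (h s)
  have hp (s : σ) : charPoly ξ (f s) s ≠ 0 := fun h0 => by
    have hle := hs s
    rw [h0, norm_zero, mul_zero, norm_le_zero_iff, Complex.ofReal_eq_zero] at hle
    exact hσ s hle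
  have hpm : Measurable fun s : σ => charPoly ξ (f s) s := by
    unfold charPoly
    fun_prop
  have hμ (s : σ) : ‖ξ + f s‖ ≤ ε⁻¹ * ‖charPoly ξ (f s) s‖ := by
    rw [inv_mul_eq_div, le_div_iff₀' hε]
    exact h s
  exact ⟨⟨_, div_mem_boundedMeasurable (by fun_prop) hpm (inv_nonneg.2 hε.le) hμ⟩,
    ⟨_, div_mem_boundedMeasurable (by fun_prop) hpm (by positivity) hs⟩,
    fun s => ⟨hp s, div_mul_cancel₀ _ (hp s), div_mul_cancel₀ _ (hp s)⟩⟩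

theorem exists_cutoff_symbol (hf : Measurable f) {ω : Set σ} (hω : MeasurableSet ω)
    (hε : 0 ≤ ε) (h : ∀ s ∈ ω, ‖charPoly ξ (f s) s‖ < ε * ‖ξ + f s‖) :
    ∃ θ : boundedMeasurable σ, (∀ s, θ.1 s * (ξ + f s) = ω.indicator 1 s * (s : ℝ)) ∧
      ∀ s, ‖ξ * ω.indicator 1 s + θ.1 s‖ ≤ ε := by
  have hne (s : σ) (hs : s ∈ ω) : ξ + f s ≠ 0 := fun h0 => by
    have hlt := h s hs
    rw [h0, norm_zero, mul_zero] at hlt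
    exact (norm_nonneg _).not_gt hlt
  let θ : σ → ℂ := ω.indicator fun s => ((s : ℝ) : ℂ) / (ξ + f s)
  have hle (s : σ) : ‖ξ * ω.indicator 1 s + θ s‖ ≤ ε := by
    by_cases hs : s ∈ ω
    · have hquot : ξ + ((s : ℝ) : ℂ) / (ξ + f s) = charPoly ξ (f s) s / (ξ + f s) := by
        rw [charPoly_eq, add_div, mul_div_cancel_right₀ _ (hne s hs)]
      simp only [θ, Set.indicator_of_mem hs, Pi.one_apply, mul_one, hquot, norm_div]
      exact div_le_of_le_mul₀ (norm_nonneg _) hε (h s hs).le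
    · simpa [θ, hs] using hε
  have hone (s : σ) : ‖ξ * ω.indicator 1 s‖ ≤ ‖ξ‖ := by by_cases hs : s ∈ ω <;> simp [hs]
  refine ⟨⟨θ, mem_boundedMeasurable (C := ε + ‖ξ‖) ?_ fun s => ?_⟩, fun s => ?_, hle⟩
  · exact Measurable.indicator (by fun_prop) hω
  · simpa using (norm_sub_le (ξ * ω.indicator 1 s + θ s) (ξ * ω.indicator 1 s)).trans
      (add_le_add (hle s) (hone s))
  · by_cases hs : s ∈ ω <;> simp [θ, hs, hne s]

end Symbols

namespace GeneratorCoordinates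

variable {H : Type*} [NormedAddCommGroup H] [InnerProductSpace ℂ H] [CompleteSpace H]
  {A : H →ₗ.[ℂ] H} {E : SpectralMeasure (realSpectrum A) H} {f : realSpectrum A → ℝ}
  (K : GeneratorCoordinates A E f) {ξ : ℂ} {ε : ℝ}

theorem ρ_ne_zero (s : realSpectrum A) : K.ρ.1 s ≠ 0 := fun h => by simpa [h] using K.ρ_sq s

/-- The operator on the phase space with matrix `(φ₁₁, φ₁₂; φ₂₁, φ₂₂)` of bounded functions of `A`
in the coordinates `(e u, v)`. -/
def matrix (φ₁₁ φ₁₂ φ₂₁ φ₂₂ : boundedMeasurable (realSpectrum A)) :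
    PhaseSpace A →L[ℂ] PhaseSpace A :=
  let x : PhaseSpace A →L[ℂ] H := K.e.toContinuousLinearEquiv.toContinuousLinearMap ∘L
    WithLp.fstL 2 ℂ (HOne A) H
  let v : PhaseSpace A →L[ℂ] H := WithLp.sndL 2 ℂ (HOne A) H
  (WithLp.prodContinuousLinearEquiv 2 ℂ (HOne A) H).symm.toContinuousLinearMap ∘L
    (K.e.symm.toContinuousLinearEquiv.toContinuousLinearMap ∘L
      (E.calculus φ₁₁ ∘L x + E.calculus φ₁₂ ∘L v)).prod
      (E.calculus φ₂₁ ∘L x + E.calculus φ₂₂ ∘L v)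

theorem e_matrix_fst (φ₁₁ φ₁₂ φ₂₁ φ₂₂ : boundedMeasurable (realSpectrum A)) (y : PhaseSpace A) :
    K.e (K.matrix φ₁₁ φ₁₂ φ₂₁ φ₂₂ y).fst = E.calculus φ₁₁ (K.e y.fst) + E.calculus φ₁₂ y.snd :=
  K.e.apply_symm_apply _

theorem matrix_snd (φ₁₁ φ₁₂ φ₂₁ φ₂₂ : boundedMeasurable (realSpectrum A)) (y : PhaseSpace A) :
    (K.matrix φ₁₁ φ₁₂ φ₂₁ φ₂₂ y).snd = E.calculus φ₂₁ (K.e y.fst) + E.calculus φ₂₂ y.snd :=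
  rfl

include K in
theorem eq_zero_of_smul_mem_graph (hp : ∀ s, charPoly ξ (f s) s ≠ 0) {U : PhaseSpace A}
    (hU : (U, ξ • U) ∈ (generator A f).graph) : U = 0 := by
  obtain ⟨hfst, hsnd⟩ := (K.mem_graph_iff _ _).1 hU
  have hsymbol (s : realSpectrum A) :
      ((K.α + ξ • K.β + ξ ^ 2 • K.κ) * K.ρ).1 s = charPoly ξ (f s) s * K.κ.1 s * K.ρ.1 s := by
    change (K.α.1 s + ξ * K.β.1 s + ξ ^ 2 * K.κ.1 s) * K.ρ.1 s = _
    rw [K.α_apply, K.β_apply, charPoly]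
    ring
  have hfst_zero : K.e U.fst = 0 := by
    refine E.calculus_injective (φ := (K.α + ξ • K.β + ξ ^ 2 • K.κ) * K.ρ) (fun s => ?_) ?_
    · rw [hsymbol]
      exact mul_ne_zero (mul_ne_zero (hp s) (K.κ_ne_zero s)) (K.ρ_ne_zero s)
    · rw [← hfst] at hsnd
      rw [map_zero, ← hsnd, WithLp.smul_snd, ← hfst, WithLp.smul_fst]
      simp only [map_mul, map_add, map_smul, mul_apply_eq_comp, add_apply, smul_apply]
      module
  refine WithLp.ofLp_injective 2 (Prod.ext (K.e.injective ?_) ?_)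
  · simpa using hfst_zero
  · rw [← WithLp.snd, ← hfst, WithLp.smul_fst, map_smul, hfst_zero]
    simp

theorem resolvent_symbol_identities {μ τ : boundedMeasurable (realSpectrum A)}
    (h : ∀ s, charPoly ξ (f s) s ≠ 0 ∧
      μ.1 s * charPoly ξ (f s) s = ξ + f s ∧ τ.1 s * charPoly ξ (f s) s = (s : ℝ)) :
    ξ • (K.ρ * μ) - K.ρ = -(K.ρ * τ) ∧
      K.α * K.ρ * μ - (K.β + ξ • K.κ) * (K.ρ * τ) = 0 ∧
      K.α * K.ρ ^ 2 * τ + ξ • ((K.β + ξ • K.κ) * (K.ρ ^ 2 * τ)) = K.κ := by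
  refine ⟨?_, ?_, ?_⟩ <;> ext s <;> obtain ⟨hp, hμ, hτ⟩ := h s
  · change ξ * (K.ρ.1 s * μ.1 s) - K.ρ.1 s = -(K.ρ.1 s * τ.1 s)
    refine mul_right_cancel₀ hp ?_
    rw [charPoly_eq] at *
    linear_combination (ξ * K.ρ.1 s) * hμ + K.ρ.1 s * hτ
  · change K.α.1 s * K.ρ.1 s * μ.1 s - (K.β.1 s + ξ * K.κ.1 s) * (K.ρ.1 s * τ.1 s) = 0
    refine mul_right_cancel₀ hp ?_
    rw [K.α_apply, K.β_apply]
    linear_combination ((s : ℝ) * K.κ.1 s * K.ρ.1 s) * hμ -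
      (f s + ξ) * K.κ.1 s * K.ρ.1 s * hτ
  · change K.α.1 s * K.ρ.1 s ^ 2 * τ.1 s +
      ξ * ((K.β.1 s + ξ * K.κ.1 s) * (K.ρ.1 s ^ 2 * τ.1 s)) = K.κ.1 s
    rw [K.α_apply, K.β_apply]
    rw [charPoly] at hτ
    linear_combination (K.κ.1 s * K.ρ.1 s ^ 2) * hτ + K.κ.1 s * K.ρ_sq s

include K in
theorem mem_resolventSet (hf : Measurable f) (hε : 0 < ε)
    (h : ∀ s, ε * ‖ξ + f s‖ ≤ ‖charPoly ξ (f s) s‖) : ξ ∈ resolventSet (generator A f) := by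
  have hσ (s : realSpectrum A) : (s : ℝ) ≠ 0 := fun h0 => by simpa [h0] using K.ρ_sq s
  obtain ⟨μ, τ, hsymbol⟩ := exists_resolvent_symbols hσ hf hε h
  obtain ⟨hfst, hsnd₁, hsnd₂⟩ := K.resolvent_symbol_identities hsymbol
  refine mem_resolventSet_of_graph (K.matrix μ (K.ρ * τ) (-(K.ρ * τ)) (ξ • (K.ρ ^ 2 * τ)))
    (fun y => (K.mem_graph_iff _ _).2 ⟨?_, ?_⟩)
    fun U => K.eq_zero_of_smul_mem_graph fun s => (hsymbol s).1
  · rw [WithLp.sub_fst, WithLp.smul_fst, map_sub, map_smul, K.e_matrix_fst, K.matrix_snd, ← hfst]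
    simp only [map_sub, map_add, map_smul, map_mul, mul_apply_eq_comp, sub_apply, smul_apply,
      pow_two]
    module
  · rw [WithLp.sub_snd, WithLp.smul_snd, K.e_matrix_fst, K.matrix_snd]
    have h₁ := congrArg (E.calculus · (K.e y.fst)) hsnd₁
    have h₂ := congrArg (E.calculus · y.snd) hsnd₂
    simp only [map_sub, map_add, map_smul, map_mul, map_neg, map_zero, mul_apply_eq_comp,
      sub_apply, add_apply, smul_apply, neg_apply, zero_apply, pow_two] at h₁ h₂ ⊢
    linear_combination (norm := module) h₁ + h₂

include K in
theorem norm_le_of_cutoff (hf : Measurable f) {ω : Set (realSpectrum A)} (hω : MeasurableSet ω)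
    (hε : 0 ≤ ε) (h : ∀ s ∈ ω, ‖charPoly ξ (f s) s‖ < ε * ‖ξ + f s‖) {x : H}
    (hx : E.proj ω x = x) : ∃ U V : PhaseSpace A, (U, V) ∈ (generator A f).graph ∧ ‖x‖ ≤ ‖U‖ ∧
      ‖ξ • U - V‖ ≤ ε * ‖x‖ := by
  obtain ⟨θ, hθ, hle⟩ := exists_cutoff_symbol hf hω hε h
  let ι : boundedMeasurable (realSpectrum A) := ⟨_, indicator_one_mem_boundedMeasurable hω⟩
  have hιx : E.calculus ι x = x := by rw [E.calculus_indicator_one hω, hx]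
  let v := -E.calculus (K.ρ * θ) x
  let U : PhaseSpace A := WithLp.toLp 2 (K.e.symm x, v)
  let V : PhaseSpace A := WithLp.toLp 2 (K.e.symm (-E.calculus θ x), ξ • v)
  have hsymbol : K.α * K.ρ * ι = (K.β + ξ • K.κ) * (K.ρ * θ) := by
    ext s
    change K.α.1 s * K.ρ.1 s * ω.indicator 1 s =
      (K.β.1 s + ξ * K.κ.1 s) * (K.ρ.1 s * θ.1 s)
    rw [K.α_apply, K.β_apply]
    linear_combination (-(K.κ.1 s * K.ρ.1 s)) * hθ s
  have hres : ξ • U - V = WithLp.toLp 2 (K.e.symm (E.calculus (ξ • ι + θ) x), 0) := by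
    refine WithLp.ofLp_injective 2 (Prod.ext ?_ (sub_self _))
    change ξ • K.e.symm x - K.e.symm (-E.calculus θ x) = K.e.symm _
    rw [← map_smul, ← map_sub, map_add, map_smul, add_apply, smul_apply, hιx, sub_neg_eq_add]
  refine ⟨U, V, (K.mem_graph_iff _ _).2 ⟨?_, ?_⟩, ?_, ?_⟩
  · change E.calculus K.ρ (K.e (K.e.symm _)) = -E.calculus (K.ρ * θ) x
    rw [K.e.apply_symm_apply, map_neg, E.calculus_mul_apply]
  · change E.calculus K.α (E.calculus K.ρ (K.e (K.e.symm x))) + E.calculus K.β v +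
      E.calculus K.κ (ξ • v) = 0
    have hx' := congrArg (E.calculus · x) hsymbol
    simp only [map_add, map_smul, map_mul, mul_apply_eq_comp, add_apply, smul_apply, hιx] at hx'
    simp only [v, K.e.apply_symm_apply, hx', map_neg, map_smul, E.calculus_mul_apply]
    module
  · exact (K.e.symm.norm_map x).symm.trans_le (WithLp.norm_fst_le _ U)
  · rw [hres, WithLp.norm_toLp_fst, K.e.symm.norm_map]
    exact E.norm_calculus_apply_le _ hε hle x

end GeneratorCoordinates

section GeneratorSpectrum

variable {H : Type*} [NormedAddCommGroup H] [InnerProductSpace ℂ H] [CompleteSpace H]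
  {A : H →ₗ.[ℂ] H} {f : realSpectrum A → ℝ} {ξ : ℂ}

theorem mem_spectrum_generator_iff (hA : IsSelfAdjoint A) (hpos : IsStrictlyPositive A)
    (hf : Continuous f) (hf0 : ∀ s, 0 ≤ f s) : ξ ∈ spectrum (generator A f) ↔
      ∀ ε > 0, ∃ s : realSpectrum A, ‖charPoly ξ (f s) s‖ < ε * ‖ξ + f s‖ := by
  obtain ⟨E, c, hE⟩ := exists_isCalculusMeasure hA hpos
  obtain ⟨K⟩ := hE.nonempty_generatorCoordinates hf.measurable hf0
  constructor
  · intro hξ ε hε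
    by_contra! hle
    exact hξ (K.mem_resolventSet hf.measurable hε hle)
  · intro hsmall hξ
    obtain ⟨C, hC, hbound⟩ := exists_bound_of_mem_resolventSet hξ
    have hε : 0 < (2 * C)⁻¹ := by positivity
    let ω : Set (realSpectrum A) := {s | ‖charPoly ξ (f s) s‖ < (2 * C)⁻¹ * ‖ξ + f s‖}
    have hω : IsOpen ω := isOpen_lt (by unfold charPoly; fun_prop) (by fun_prop)
    refine hE.isSpectralMeasureOf.proj_ne_zero hA hω (hsmall _ hε) ?_
    ext x
    obtain ⟨U, V, hUV, hxU, hres⟩ := K.norm_le_of_cutoff hf.measurable hω.measurableSet hε.le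
      (fun _ hs => hs) (E.proj_proj x hω.measurableSet)
    obtain ⟨U, rfl, rfl⟩ := (generator A f).mem_graph_iff.1 hUV
    have hle : ‖E.proj ω x‖ ≤ ‖E.proj ω x‖ / 2 :=
      calc ‖E.proj ω x‖ ≤ C * ((2 * C)⁻¹ * ‖E.proj ω x‖) :=
            hxU.trans ((hbound U).trans (mul_le_mul_of_nonneg_left hres hC.le))
        _ = ‖E.proj ω x‖ / 2 := by field_simp
    exact norm_le_zero_iff.1 (by linarith)

end GeneratorSpectrum

/-! ### Roots and limits at infinity -/

theorem charPoly_eq_mul {a s : ℝ} (ha : 0 ≤ a) (hs : 0 ≤ s) (ξ : ℂ) :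
    charPoly ξ a s = (ξ - xiPlus a s) * (ξ - xiMinus a s) := by
  have hiff : 2 * √s ≤ a ↔ 4 * s ≤ a ^ 2 := by
    rw [← pow_le_pow_iff_left₀ (by positivity) ha two_ne_zero, mul_pow, Real.sq_sqrt hs]
    norm_num
  rw [charPoly, xiPlus, xiMinus]
  split_ifs with h
  · have hsq : ((√(a ^ 2 - 4 * s) : ℝ) : ℂ) ^ 2 = (a : ℂ) ^ 2 - 4 * s := by
      exact_mod_cast Real.sq_sqrt (sub_nonneg.2 (hiff.1 h))
    linear_combination (1 / 4 : ℂ) * hsq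
  · have hsq : ((√(4 * s - a ^ 2) : ℝ) : ℂ) ^ 2 = 4 * s - (a : ℂ) ^ 2 := by
      exact_mod_cast Real.sq_sqrt (sub_nonneg.2 (not_le.1 (mt hiff.2 h)).le)
    linear_combination
      (-1 / 4 : ℂ) * hsq + ((√(4 * s - a ^ 2) : ℝ) : ℂ) ^ 2 / 4 * Complex.I_sq

theorem charPoly_eq_zero_iff {a s : ℝ} (ha : 0 ≤ a) (hs : 0 ≤ s) {ξ : ℂ} :
    charPoly ξ a s = 0 ↔ ξ = xiPlus a s ∨ ξ = xiMinus a s := by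
  rw [charPoly_eq_mul ha hs, mul_eq_zero, sub_eq_zero, sub_eq_zero]

theorem forall_exists_norm_charPoly_lt_iff {ι : Type*} {a s : ι → ℝ} {ξ : ℂ} (hξ : ξ ≠ 0) :
    (∀ ε > 0, ∃ i, ‖charPoly ξ (a i) (s i)‖ < ε * ‖ξ + a i‖) ↔
      ∃ x : ℕ → ι, Tendsto (fun n => (s (x n) : ℂ) / (ξ + a (x n))) atTop (𝓝 (-ξ)) := by
  have hquot {i : ι} (hi : ξ + a i ≠ 0) {ε : ℝ} :
      ‖charPoly ξ (a i) (s i)‖ < ε * ‖ξ + a i‖ ↔ dist ((s i : ℂ) / (ξ + a i)) (-ξ) < ε := by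
    rw [dist_eq_norm, sub_neg_eq_add, add_comm (_ / _), charPoly_eq,
      ← div_lt_iff₀ (norm_pos_iff.2 hi), ← norm_div, add_div, mul_div_cancel_right₀ _ hi]
  constructor
  · intro h
    choose x hx using fun n : ℕ => h (1 / ((n : ℝ) + 1)) Nat.one_div_pos_of_nat
    refine ⟨x, tendsto_iff_dist_tendsto_zero.2 (squeeze_zero (fun _ => dist_nonneg) (fun n => ?_)
      tendsto_one_div_add_atTop_nhds_zero_nat)⟩
    refine ((hquot fun h0 => ?_).1 (hx n)).le
    simpa [h0] using (norm_nonneg _).trans_lt (hx n)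
  · rintro ⟨x, hx⟩ ε hε
    obtain ⟨n, hn, hne⟩ := ((Metric.tendsto_nhds.1 hx ε hε).and
      (hx.eventually_ne (neg_ne_zero.2 hξ))).exists
    exact ⟨x n, (hquot (div_ne_zero_iff.1 hne).2).2 hn⟩

theorem tendsto_div_add_iff {ι : Type*} {l : Filter ι} {a s : ι → ℝ} {ξ : ℂ} (hξ : ξ ≠ 0)
    (hs : Tendsto s l atTop) : Tendsto (fun i => (s i : ℂ) / (ξ + a i)) l (𝓝 (-ξ)) ↔
      Tendsto (fun i => ((a i / s i : ℝ) : ℂ)) l (𝓝 (-1 / ξ)) := by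
  have hzero : Tendsto (fun i => ξ / (s i : ℂ)) l (𝓝 0) := by
    have hinv : Tendsto (fun i => (((s i)⁻¹ : ℝ) : ℂ)) l (𝓝 ((0 : ℝ) : ℂ)) :=
      (Complex.continuous_ofReal.tendsto _).comp (tendsto_inv_atTop_zero.comp hs)
    simpa [div_eq_mul_inv] using hinv.const_mul ξ
  rw [← tendsto_inv_iff₀ (neg_ne_zero.2 hξ), show (-ξ)⁻¹ = 0 + -1 / ξ by simp [neg_div, inv_neg]]
  simp only [inv_div, add_div, Complex.ofReal_div]
  exact ⟨fun h => by simpa using h.sub hzero, hzero.add⟩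

section Limits

variable {H : Type*} [NormedAddCommGroup H] [InnerProductSpace ℂ H]
  {A : H →ₗ.[ℂ] H} {f : realSpectrum A → ℝ} {ξ : ℂ}

theorem exists_mem_limitSet_iff (hσ : ∀ s : realSpectrum A, 0 ≤ (s : ℝ)) (hf0 : ∀ s, 0 ≤ f s)
    (hξ : ξ ≠ 0) : (∃ l ∈ limitSet A f, ξ = -1 / (l : ℂ)) ↔
      ∃ x : ℕ → realSpectrum A, Tendsto (fun n => (x n : ℝ)) atTop atTop ∧
        Tendsto (fun n => ((x n : ℝ) : ℂ) / (ξ + f (x n))) atTop (𝓝 (-ξ)) := by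
  constructor
  · rintro ⟨l, ⟨-, x, hx, hlim⟩, rfl⟩
    refine ⟨x, hx, (tendsto_div_add_iff hξ hx).2 ?_⟩
    rw [div_div_cancel₀ (neg_ne_zero.2 one_ne_zero)]
    exact (Complex.continuous_ofReal.tendsto _).comp hlim
  · rintro ⟨x, hx, hquot⟩
    have hlim := (tendsto_div_add_iff hξ hx).1 hquot
    obtain ⟨l, hl⟩ := Complex.isometry_ofReal.isClosedEmbedding.isClosed_range.mem_of_tendsto hlim
      (.of_forall fun n => Set.mem_range_self _)
    rw [← hl] at hlim
    replace hlim := Complex.isometry_ofReal.isClosedEmbedding.tendsto_nhds_iff.2 hlim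
    have hl0 : l ≠ 0 := by
      rintro rfl
      exact div_ne_zero (neg_ne_zero.2 one_ne_zero) hξ hl.symm
    refine ⟨l, ⟨lt_of_le_of_ne ?_ hl0.symm, x, hx, hlim⟩, ?_⟩
    · exact ge_of_tendsto' hlim fun n => div_nonneg (hf0 _) (hσ _)
    · rw [hl, div_div_cancel₀ (neg_ne_zero.2 one_ne_zero)]

theorem exists_charPoly_eq_zero_of_tendsto {σ : Set ℝ} {f : σ → ℝ} {ξ : ℂ} (hσ : IsClosed σ)
    (hbdd : BddBelow σ) (hf : Continuous f) (hξ : ξ ≠ 0) {x : ℕ → σ}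
    (hx : ¬ Tendsto (fun n => (x n : ℝ)) atTop atTop)
    (hquot : Tendsto (fun n => ((x n : ℝ) : ℂ) / (ξ + f (x n))) atTop (𝓝 (-ξ))) :
    ∃ s, charPoly ξ (f s) s = 0 := by
  obtain ⟨c, hc⟩ := hbdd
  obtain ⟨b, hb⟩ : ∃ b : ℝ, ∃ᶠ n in atTop, (x n : ℝ) < b := by
    simpa only [tendsto_atTop, not_forall, not_eventually, not_le] using hx
  obtain ⟨s, -, φ, hφ, hs⟩ :=
    (hσ.isClosedEmbedding_subtypeVal.isCompact_preimage isCompact_Icc).tendsto_subseq'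
      (hb.mono fun n hn => (⟨hc (x n).2, hn.le⟩ : (x n : ℝ) ∈ Set.Icc c b))
  have hden : Tendsto (fun n => ξ + f (x (φ n))) atTop (𝓝 (ξ + f s)) :=
    ((by fun_prop : Continuous fun s => ξ + (f s : ℂ)).tendsto s).comp hs
  have hnum : Tendsto (fun n => ((x (φ n) : ℝ) : ℂ)) atTop (𝓝 (s : ℝ)) :=
    ((by fun_prop : Continuous fun s : σ => ((s : ℝ) : ℂ)).tendsto s).comp hs
  replace hquot := hquot.comp hφ.tendsto_atTop
  have hlim : -ξ * (ξ + f s) = (s : ℝ) := by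
    refine tendsto_nhds_unique (hquot.mul hden) (hnum.congr' ?_)
    filter_upwards [hquot.eventually_ne (neg_ne_zero.2 hξ)] with n hn
    exact (div_mul_cancel₀ _ (div_ne_zero_iff.1 hn).2).symm
  exact ⟨s, by rw [charPoly_eq, ← hlim, neg_mul, add_neg_cancel]⟩

theorem forall_exists_norm_charPoly_lt_iff_exists_root_or_limit (hσ : IsClosed (realSpectrum A))
    (hpos : ∀ s : realSpectrum A, 0 < (s : ℝ)) (hf : Continuous f) (hf0 : ∀ s, 0 ≤ f s)
    (hξ : ξ ≠ 0) :
    (∀ ε > 0, ∃ s : realSpectrum A, ‖charPoly ξ (f s) s‖ < ε * ‖ξ + f s‖) ↔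
      (∃ s : realSpectrum A, charPoly ξ (f s) s = 0) ∨ ∃ l ∈ limitSet A f, ξ = -1 / (l : ℂ) := by
  rw [forall_exists_norm_charPoly_lt_iff hξ, exists_mem_limitSet_iff (fun s => (hpos s).le) hf0 hξ]
  constructor
  · rintro ⟨x, hx⟩
    by_cases htop : Tendsto (fun n => (x n : ℝ)) atTop atTop
    · exact .inr ⟨x, htop, hx⟩
    · exact .inl (exists_charPoly_eq_zero_of_tendsto hσ ⟨0, fun s hs => (hpos ⟨s, hs⟩).le⟩ hf hξ
        htop hx)
  · rintro (⟨s, hs⟩ | ⟨x, -, hx⟩)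
    · refine ⟨fun _ => s, tendsto_const_nhds.congr fun _ => ?_⟩
      have hprod : ξ * (ξ + f s) + (s : ℝ) = 0 := by rwa [← charPoly_eq]
      have hden : ξ + f s ≠ 0 := fun h0 => (hpos s).ne' (by simpa [h0] using hprod)
      exact (eq_div_iff hden).2 (by linear_combination -hprod)
    · exact ⟨x, hx⟩

theorem ne_zero_of_root_or_limit (hpos : ∀ s : realSpectrum A, 0 < (s : ℝ))
    (h : (∃ s : realSpectrum A, charPoly ξ (f s) s = 0) ∨ ∃ l ∈ limitSet A f, ξ = -1 / (l : ℂ)) :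
    ξ ≠ 0 := by
  obtain ⟨s, hs⟩ | ⟨l, hl, rfl⟩ := h
  · rintro rfl
    exact (hpos s).ne' (by simpa [charPoly] using hs)
  · exact div_ne_zero (neg_ne_zero.2 one_ne_zero) (Complex.ofReal_ne_zero.2 hl.1.ne')

end Limits

end DampedEvolution

end

open DampedEvolution in
theorem mainTheorem6_general {H : Type*} [NormedAddCommGroup H] [InnerProductSpace ℂ H]
    [CompleteSpace H] (A : H →ₗ.[ℂ] H) (hA : IsSelfAdjoint A)
    (hpos : DampedEvolution.IsStrictlyPositive A) (f : DampedEvolution.realSpectrum A → ℝ)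
    (hf : Continuous f) (hf0 : ∀ s, 0 ≤ f s) :
    DampedEvolution.spectrum (DampedEvolution.generator A f) \ {0} =
      (⋃ s : DampedEvolution.realSpectrum A,
        {DampedEvolution.xiPlus (f s) s, DampedEvolution.xiMinus (f s) s}) ∪
      ⋃ l ∈ DampedEvolution.limitSet A f, {-1 / (l : ℂ)} := by
  obtain ⟨c, hc, hlower⟩ := hpos
  have hσ (s : realSpectrum A) : 0 < (s : ℝ) :=
    hc.trans_le (le_of_mem_realSpectrum hA hlower s.2)
  have hroot (ξ : ℂ) (s : realSpectrum A) : ξ = xiPlus (f s) s ∨ ξ = xiMinus (f s) s ↔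
      charPoly ξ (f s) s = 0 := (charPoly_eq_zero_iff (hf0 s) (hσ s).le).symm
  have hcriterion {ξ : ℂ} (hξ : ξ ≠ 0) := (mem_spectrum_generator_iff hA ⟨c, hc, hlower⟩ hf hf0
    (ξ := ξ)).trans (forall_exists_norm_charPoly_lt_iff_exists_root_or_limit
      (isClosed_realSpectrum hA) hσ hf hf0 hξ)
  ext ξ
  simp only [Set.mem_sdiff, Set.mem_singleton_iff, Set.mem_union, Set.mem_iUnion,
    Set.mem_insert_iff, exists_prop, hroot]
  refine ⟨fun ⟨hmem, hξ⟩ => (hcriterion hξ).1 hmem, fun h => ?_⟩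
  have hξ := ne_zero_of_root_or_limit hσ h
  exact ⟨(hcriterion hξ).2 h, hξ⟩

theorem mainTheorem6 {H : Type*} [NormedAddCommGroup H] [InnerProductSpace ℂ H] [CompleteSpace H]
    [TopologicalSpace.SeparableSpace H]
    (A : H →ₗ.[ℂ] H) (hA : IsSelfAdjoint A) (hpos : DampedEvolution.IsStrictlyPositive A)
    (f : DampedEvolution.realSpectrum A → ℝ) (hf : Continuous f) (hf0 : ∀ s, 0 ≤ f s) :
    DampedEvolution.spectrum (DampedEvolution.generator A f) \ {0} =
      (⋃ s : DampedEvolution.realSpectrum A,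
        {DampedEvolution.xiPlus (f s) s, DampedEvolution.xiMinus (f s) s}) ∪
      ⋃ l ∈ DampedEvolution.limitSet A f, {-1 / (l : ℂ)} :=
  mainTheorem6_general A hA hpos f hf hf0
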